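/- Let $N=n^2M$, where $n$ is a positive divisor of $24$ and $M$ is a squarefree positive integer. For a positive divisor $m$ of $N$ let $h(m)$ be the largest integer such that $m\,h(m)^2\mid N$, and for an integer $k$ put $\eta_{m,k}(\tau)=\eta(m\tau+k/h(m))$, where $\eta(\tau)=e^{2\pi i\tau/24}\prod_{\ell\ge1}(1-e^{2\pi i\ell\tau})$ is the Dedekind eta function on the upper half-plane. Below, $\sum_{m,k}$ and $\prod_{m,k}$ run over all pairs of integers $(m,k)$ with $m\ge 1$, $m\mid N$ and $0\le k\le h(m)-1$; $(h(m),k)$ denotes the greatest common divisor, and $\mathrm{ord}_2$ the $2$-adic valuation. Let $e_{m,k}$ be integers. Then $$\prod_{m,k}\eta_{m,k}^{e_{m,k}}$$ is a modular function on $X_0(N)$ (that is, meromorphic on the upper half-plane, invariant under $\Gamma_0(N)$, and meromorphic at all cusps) if and only if the following conditions all hold: (a) $\sum_{m,k}e_{m,k}=0$; (b) $\sum_{m,k}e_{m,k}\,m\equiv0\pmod{24}$; (c) $\sum_{m,k}e_{m,k}\dfrac{N\,(h(m),k)^2}{m\,h(m)^2}\equiv0\pmod{24}$; (d) (i) if $n$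 is odd (that is, $n\in\{1,3\}$), then $\sum_{m,k}e_{m,k}\,k\equiv0\pmod 3$ and $\prod_{m,k}m^{e_{m,k}}$ is the square of a rational number; (ii) if $n$ is even, then $$\sum_{m,k}e_{m,k}\left(\frac{kn}{h(m)}+\frac n2\,\mathrm{ord}_2(m)\right)\equiv0\pmod n$$ and the odd part of $\prod_{m,k}m^{e_{m,k}}$ (the quotient of this rational number by the power of $2$ that exactly divides it) is the square of a rational number. -/

import Mathlib

open UpperHalfPlane
open scoped MatrixGroups

noncomputable section

namespace ModularUnits

/-- A modular function on `X_0(N)`: a meromorphic function on the upper half-plane, invariant under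
`Γ_0(N)` and meromorphic at every cusp. Every cusp is `γ∞` for some `γ ∈ SL(2, ℤ)`, and its width
divides `N`, so meromorphy there means that `f (γ τ)` is, for `Im τ` large, a function of
`q_N = exp (2πiτ/N)` which is meromorphic at `q_N = 0`. -/
structure IsModularFunction (N : ℕ) (f : ℍ → ℂ) : Prop where
  meromorphicOn : MeromorphicOn (fun z : ℂ => f (ofComplex z)) {z : ℂ | 0 < z.im}
  invariant : ∀ γ ∈ CongruenceSubgroup.Gamma0 N, ∀ τ : ℍ, f (γ • τ) = f τ
  meromorphicAt_cusps : ∀ γ : SL(2, ℤ), ∃ g : ℂ → ℂ, MeromorphicAt g 0 ∧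
    ∀ᶠ τ : ℍ in atImInfty, f (γ • τ) = g (Function.Periodic.qParam (N : ℝ) (τ : ℂ))

/-- The largest integer `h` with `m h² ∣ N` (for `m ∣ N`, `N ≠ 0`; such an `h` is at most `N`). -/
def h (N m : ℕ) : ℕ := Nat.findGreatest (fun h => m * h ^ 2 ∣ N) N

/-- `η_{m,k}(τ) = η(m τ + k / h(m))`. -/
def etaMK (N m k : ℕ) (τ : ℍ) : ℂ :=
  ModularForm.eta ((m : ℂ) * (τ : ℂ) + (k : ℂ) / (h N m : ℂ))

/-- The set of pairs `(m, k)` with `m ∣ N` and `0 ≤ k ≤ h(m) - 1`. -/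
def pairs (N : ℕ) : Finset (Σ _ : ℕ, ℕ) :=
  N.divisors.sigma fun m => Finset.range (h N m)

/-- The product `∏ η_{m,k} ^ e_{m,k}` over all pairs `(m, k)`. -/
def etaProduct (N : ℕ) (e : ℕ → ℕ → ℤ) (τ : ℍ) : ℂ :=
  ∏ p ∈ pairs N, etaMK N p.1 p.2 τ ^ e p.1 p.2

/-- The odd part `x / 2 ^ ord₂(x)` of a nonzero rational number `x`. -/
def oddPart (x : ℚ) : ℚ := x / (2 : ℚ) ^ padicValRat 2 x

/-- `h N m` is the largest `h` with `m h² ∣ N`. -/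
theorem isGreatest_h {N m : ℕ} (hN : N ≠ 0) (hm : m ∣ N) :
    IsGreatest {h : ℕ | m * h ^ 2 ∣ N} (h N m) := by
  refine ⟨?_, fun j hj => ?_⟩
  · exact Nat.findGreatest_spec (P := fun h => m * h ^ 2 ∣ N) (m := 1)
      (Nat.one_le_iff_ne_zero.2 hN) (by simpa using hm)
  · refine Nat.le_findGreatest ?_ hj
    have h1 : j ∣ N := (dvd_pow_self j two_ne_zero).trans ((Dvd.intro_left m rfl).trans hj)
    exact Nat.le_of_dvd (Nat.pos_of_ne_zero hN) h1

end ModularUnits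

end

/-! The eta quotient has no zeros or poles on the half-plane, so its law under Γ₀(N) decides
everything. Conjugating (a b; c d) in Γ₀(N) by τ ↦ mτ + k/h produces integer entries: the only
doubtful term is k(d - a)/h, and h ∣ n ∣ 24, while a unit modulo a divisor of 24 is its own inverse.
So the classical eta multiplier (`eta_mobius`) applies to the conjugate. Writing c = h²ms and g =
gcd(h, k), for d > 0 prime to 6 it simplifies (`eta_conj`) to the Jacobi symbol (s/d) times ζ₂₄ to
the power mbd + k(d² - 1)/h - dsg² + 3(d - 1), next to the weight factor √(cτ + d).

In the product the weight factor forces (a). The terms in b and in c give (b) and (c), seen on τ ↦ τ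
+ 1 and on (1 0; N 1). What is left is ∏ (m/d)^e · ζ₂₄^(DK), with D = (d² - 1)/24 and K = ∑ e·24k/h;
it must be 1 for every d > 0 prime to 6N (`invariant_iff`).

The Chinese remainder theorem isolates the constraints. For each odd prime p ∣ N some d has 24 ∣ D
and (p/d) = -1, the other primes of N having symbol 1, so p occurs in ∏ m^e to an even power. The
prime 2 is different: (2/d) = ζ₂₄^(12D), so its exponent merges with K, and a d with D prime to 24
gives 24 ∣ K + 12·ord₂. If n is odd then 8 ∣ K, and a d with 3 ∣ D and (2/d) = -1 separates the two
conditions.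

Meromorphy at the cusps is then automatic. Since |η|⁴·Im is SL(2, ℤ)-invariant and an integral
matrix is an SL(2, ℤ) matrix times a triangular one, a weight-zero quotient grows at most
exponentially at each cusp. It has period N there, so a power of q_N makes it bounded and the
singularity removable. -/

noncomputable section

namespace ModularUnits

open Complex hiding eta
open ModularForm
open scoped NumberTheorySymbols Real

/-! ### Eta under translation and inversion; principal square roots -/

/-- The primitive 24th root of unity `exp (2πi/24)`. -/
def zeta : ℂ := cexp (2 * π * Complex.I / 24)

lemma isPrimitiveRoot_zeta : IsPrimitiveRoot zeta 24 := by
  simpa [zeta] using Complex.isPrimitiveRoot_exp 24 (by norm_num)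

lemma zeta_ne_zero : zeta ≠ 0 := Complex.exp_ne_zero _

lemma zeta_zpow_eq_one_iff (x : ℤ) : zeta ^ x = 1 ↔ (24 : ℤ) ∣ x := by
  simpa using isPrimitiveRoot_zeta.zpow_eq_one_iff_dvd x

lemma zeta_zpow_congr {x y : ℤ} (h : (24 : ℤ) ∣ x - y) : zeta ^ x = zeta ^ y := by
  rw [← sub_add_cancel x y, zpow_add₀ zeta_ne_zero, (zeta_zpow_eq_one_iff _).2 h, one_mul]

lemma zeta_zpow_twelve : zeta ^ (12 : ℤ) = -1 := by
  rw [zeta, ← Complex.exp_int_mul, ← Complex.exp_pi_mul_I]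
  congr 1
  push_cast
  ring

lemma neg_one_pow_eq_zeta (x : ℕ) : (-1 : ℂ) ^ x = zeta ^ (12 * (x : ℤ)) := by
  rw [zpow_mul, zeta_zpow_twelve, zpow_natCast]

lemma norm_zeta : ‖zeta‖ = 1 := by
  rw [zeta, show (2 * π * Complex.I / 24 : ℂ) = ((2 * π / 24 : ℝ) : ℂ) * Complex.I by push_cast; ring,
    Complex.norm_exp_ofReal_mul_I]

lemma sqrt_I_eq : Complex.sqrt Complex.I = zeta ^ (3 : ℤ) := by
  rw [_root_.sqrt_eq_exp I_ne_zero, Complex.log_I, zeta, ← Complex.exp_int_mul]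
  congr 1
  push_cast
  ring

lemma eta_add_one (z : ℂ) : eta (z + 1) = zeta * eta z := by
  have h1 : Function.Periodic.qParam 1 (z + 1) = Function.Periodic.qParam 1 z := by
    simp only [Function.Periodic.qParam]
    rw [Complex.exp_eq_exp_iff_exists_int]
    exact ⟨1, by push_cast; ring⟩
  have h2 : Function.Periodic.qParam 24 (z + 1) = zeta * Function.Periodic.qParam 24 z := by
    simp only [Function.Periodic.qParam, zeta]
    rw [← Complex.exp_add]
    congr 1
    push_cast
    ring
  simp only [eta, eta_q, h1, h2, mul_assoc]

lemma eta_add_int (z : ℂ) (j : ℤ) : eta (z + j) = zeta ^ j * eta z := by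
  induction j using Int.induction_on with
  | zero => simp
  | succ i ih =>
    have := eta_add_one (z + (i : ℤ))
    rw [ih] at this
    push_cast at this ⊢
    rw [← add_assoc, this, zpow_add₀ zeta_ne_zero, zpow_one]
    ring
  | pred i ih =>
    have := eta_add_one (z + ((-(i : ℤ) - 1 : ℤ) : ℂ))
    rw [show z + ((-(i : ℤ) - 1 : ℤ) : ℂ) + 1 = z + ((-(i : ℤ) : ℤ) : ℂ) by push_cast; ring, ih]
      at this
    have h2 : zeta ^ (-(i : ℤ)) = zeta * zeta ^ (-(i : ℤ) - 1) := by
      rw [← zpow_one_add₀ zeta_ne_zero]; congr 1; ring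
    rw [h2, mul_assoc] at this
    exact (mul_left_cancel₀ zeta_ne_zero this).symm

lemma eta_neg_inv {z : ℂ} (hz : 0 < z.im) :
    eta (-1 / z) = zeta ^ (-3 : ℤ) * (Complex.sqrt z * eta z) := by
  have := eta_comp_eq_csqrt_I_inv (show z ∈ upperHalfPlaneSet from hz)
  simp only [Function.comp, Pi.smul_apply, Pi.mul_apply, smul_eq_mul, sqrt_I_eq] at this
  rw [this, zpow_neg]

/-- As z/(z + 1) = 1 - 1/(z + 1), this map is translation, inversion, translation, with roots of
unity ζ·ζ⁻³·ζ = ζ⁻¹. -/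
lemma eta_div_add_one {z : ℂ} (hz : 0 < z.im) :
    eta (z / (z + 1)) = zeta⁻¹ * (Complex.sqrt (z + 1) * eta z) := by
  have hz1 : 0 < (z + 1).im := by simpa using hz
  have hne : z + 1 ≠ 0 := by
    intro h; simp [h] at hz1
  rw [show z / (z + 1) = -1 / (z + 1) + 1 by field_simp; ring, eta_add_one, eta_neg_inv hz1,
    eta_add_one]
  have : zeta * zeta ^ (-3 : ℤ) * zeta = zeta⁻¹ := by
    rw [← zpow_one_add₀ zeta_ne_zero, ← zpow_add_one₀ zeta_ne_zero]
    norm_num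
  rw [← this]
  ring

/-- Principal square roots multiply as long as all three numbers have nonnegative imaginary part
and none of the factors is a nonpositive real. -/
lemma sqrt_mul_of_im_nonneg {u w : ℂ} (hu : u ≠ 0) (hw : 0 < w.im) (hu0 : 0 ≤ u.im)
    (huw : 0 ≤ (u * w).im) (hur : u.im = 0 → 0 < u.re) :
    Complex.sqrt (u * w) = Complex.sqrt u * Complex.sqrt w := by
  have hw0 : w ≠ 0 := by rintro rfl; simp at hw
  have h1 : 0 ≤ u.arg := Complex.arg_nonneg_iff.2 hu0
  have h2 : 0 ≤ w.arg := Complex.arg_nonneg_iff.2 hw.le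
  have h3 : u.arg < π := by
    refine lt_of_le_of_ne (Complex.arg_le_pi u) fun h => ?_
    rw [Complex.arg_eq_pi_iff] at h
    linarith [hur h.2]
  have h4 : w.arg < π := by
    refine lt_of_le_of_ne (Complex.arg_le_pi w) fun h => ?_
    rw [Complex.arg_eq_pi_iff] at h
    linarith
  -- An argument sum strictly between π and 2π would put the product in the lower half-plane.
  have h5 : u.arg + w.arg ≤ π := by
    by_contra! h
    have h6 : (u * w).im = ‖u‖ * ‖w‖ * Real.sin (u.arg + w.arg) := by
      conv_lhs => rw [← Complex.norm_mul_cos_add_sin_mul_I u, ← Complex.norm_mul_cos_add_sin_mul_I w]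
      rw [Real.sin_add]
      simp [← Complex.ofReal_cos, ← Complex.ofReal_sin, -Complex.norm_mul_cos_arg,
        -Complex.norm_mul_sin_arg, -Complex.norm_mul_cos_add_sin_mul_I]
      ring
    have h7 : Real.sin (u.arg + w.arg) < 0 := by
      have := Real.sin_pos_of_pos_of_lt_pi (x := u.arg + w.arg - π) (by linarith) (by linarith)
      rw [Real.sin_sub_pi] at this
      linarith
    have : 0 < ‖u‖ * ‖w‖ := mul_pos (norm_pos_iff.2 hu) (norm_pos_iff.2 hw0)
    nlinarith
  rw [_root_.sqrt_eq_exp hu, _root_.sqrt_eq_exp hw0, _root_.sqrt_eq_exp (mul_ne_zero hu hw0),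
    (Complex.log_mul_eq_add_log_iff hu hw0).2 ⟨by linarith [Real.pi_pos], h5⟩, ← Complex.exp_add]
  congr 1
  ring

/-! ### Jacobi symbols and the eta multiplier -/

lemma jacobiSym_add_left_self (x y : ℕ) : J((x + y : ℕ) | y) = J(x | y) := by
  apply jacobiSym.mod_left'
  push_cast
  simp

/-- Periodicity defect of the Jacobi symbol with even numerator. -/
lemma jacobiSym_even_add_self {x y : ℕ} (hx : Even x) (hy : Odd y) :
    J(x | x + y) = (-1) ^ ((x / 2) * (1 + y / 2)) * J(x | y) := by
  have hxy : Odd (x + y) := hx.add_odd hy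
  have h1 : J(x | x + y) = J(-(y : ℤ) | x + y) := by
    apply jacobiSym.mod_left'
    push_cast
    exact Int.modEq_iff_dvd.2 ⟨-1, by ring⟩
  -- The sign is that of -1 modulo x + y times that of reciprocity between y and x + y; the
  -- reciprocal symbol has numerator x + y ≡ x modulo y.
  rw [h1, jacobiSym.neg _ hxy, jacobiSym.quadratic_reciprocity hy hxy, jacobiSym_add_left_self,
    ZMod.χ₄_eq_neg_one_pow (Nat.odd_iff.1 hxy), ← mul_assoc, ← pow_add]
  congr 1
  obtain ⟨c, rfl⟩ := hx
  obtain ⟨d, rfl⟩ := hy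
  rw [show (c + c + (2 * d + 1)) / 2 = c + d by omega, show (2 * d + 1) / 2 = d by omega,
    show (c + c) / 2 = c by omega, neg_one_pow_eq_pow_mod_two, neg_one_pow_eq_pow_mod_two (n := _ * _)]
  congr 1
  obtain ⟨t, ht⟩ := Nat.even_mul_succ_self d
  have : c + d + d * (c + d) = c * (1 + d) + 2 * t := by rw [two_mul, ← ht]; ring
  omega

/-- The multiplier of the eta function at the matrix `(a b; c d)`, `c ≥ 0`, `d > 0`. -/
def etaMult (a b : ℤ) (c d : ℕ) : ℂ :=
  if Odd d then
    J(c | d) * zeta ^ ((a + d) * c - b * d * (c ^ 2 - 1) + 3 * d - 3 - 3 * c * d : ℤ)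
  else J(d | c) * zeta ^ ((a + d) * c - b * d * (c ^ 2 - 1) - 3 * c : ℤ)

/-- When c and d are both odd, the two branches of the definition agree by quadratic reciprocity.
Hence odd c always allows the symbol with modulus c, whatever the parity of d. -/
lemma etaMult_of_odd {a b : ℤ} {c d : ℕ} (hc : Odd c) :
    etaMult a b c d = J(d | c) * zeta ^ ((a + d) * c - b * d * (c ^ 2 - 1) - 3 * c : ℤ) := by
  by_cases hd : Odd d
  · rw [etaMult, if_pos hd, jacobiSym.quadratic_reciprocity hc hd]
    push_cast
    rw [neg_one_pow_eq_zeta, mul_comm (zeta ^ _), mul_assoc, ← zpow_add₀ zeta_ne_zero]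
    congr 2
    obtain ⟨x, rfl⟩ := hc
    obtain ⟨y, rfl⟩ := hd
    rw [show (2 * x + 1) / 2 = x by omega, show (2 * y + 1) / 2 = y by omega]
    push_cast
    ring
  · rw [etaMult, if_neg hd]

lemma twentyfour_dvd_of_odd {x : ℤ} (hx : Odd x) : (24 : ℤ) ∣ x * (x ^ 2 - 1) := by
  have h3 : (3 : ℤ) ∣ x * (x ^ 2 - 1) := by
    have : x % 3 = 0 ∨ x % 3 = 1 ∨ x % 3 = 2 := by omega
    apply Int.dvd_of_emod_eq_zero
    rcases this with h | h | h <;> simp [pow_two, Int.mul_emod, Int.sub_emod, h]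
  have h8 : (8 : ℤ) ∣ x * (x ^ 2 - 1) := (Int.eight_dvd_sq_sub_one_of_odd hx).mul_left x
  omega

/-- The congruence left over in `etaMult_T` and `etaMult_U` when the modulus of the symbol moves: 2x
is the even entry, 2y + 1 the odd one, and 12x(1 + y) encodes the sign of `jacobiSym_even_add_self`.
-/
lemma twentyfour_dvd_aux {x X y : ℤ} (h : (4 : ℤ) ∣ x * (X + 3 + 2 * y)) :
    (24 : ℤ) ∣ -(2 * x * ((2 * x) ^ 2 - 1) * X) + 3 * (2 * x) * (1 - 2 * x) + 12 * (x * (1 + y)) := by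
  have h3 : (3 : ℤ) ∣ 2 * x * ((2 * x) ^ 2 - 1) := by
    generalize 2 * x = z
    have : z % 3 = 0 ∨ z % 3 = 1 ∨ z % 3 = 2 := by omega
    apply Int.dvd_of_emod_eq_zero
    rcases this with h | h | h <;> simp [pow_two, Int.mul_emod, Int.sub_emod, h]
  obtain ⟨u, hu⟩ := h3
  obtain ⟨v, hv⟩ := h
  obtain ⟨w, hw⟩ := Int.even_mul_succ_self x
  have e3 : (3 : ℤ) ∣ -(2 * x * ((2 * x) ^ 2 - 1) * X) + 3 * (2 * x) * (1 - 2 * x) +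
      12 * (x * (1 + y)) :=
    ⟨-u * X + 2 * x * (1 - 2 * x) + 4 * (x * (1 + y)), by rw [hu]; ring⟩
  have e8 : (8 : ℤ) ∣ -(2 * x * ((2 * x) ^ 2 - 1) * X) + 3 * (2 * x) * (1 - 2 * x) +
      12 * (x * (1 + y)) :=
    ⟨-x ^ 3 * X + v + x * y + 3 * x - 3 * w, by linear_combination 2 * hv - 12 * hw⟩
  omega

/-- This is right multiplication by τ ↦ τ + 1, which fixes c. For odd c the modulus c is kept and 24
∣ c(c² - 1) suffices; for even c the modulus passes from d to d + c and costs a sign. -/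
lemma etaMult_T {a b : ℤ} {c d : ℕ} (h : a * d - b * c = 1) :
    etaMult a (b + a) c (d + c) = zeta * etaMult a b c d := by
  by_cases hc : Odd c
  · rw [etaMult_of_odd hc, etaMult_of_odd hc, jacobiSym_add_left_self, mul_left_comm, ← zpow_one_add₀ zeta_ne_zero]
    congr 1
    apply zeta_zpow_congr
    push_cast
    obtain ⟨t, ht⟩ := twentyfour_dvd_of_odd (x := c) (by exact_mod_cast hc)
    exact ⟨-t * (2 * b + a), by linear_combination -(2 * b + a) * ht - (c ^ 2 - 1) * h⟩
  · rw [Nat.not_odd_iff_even] at hc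
    have hd : Odd d := by
      rw [← Nat.not_even_iff_odd]
      intro hd
      obtain ⟨x, rfl⟩ := hc
      obtain ⟨y, rfl⟩ := hd
      push_cast at h
      have : 2 * (a * y - b * x) = 1 := by linarith
      omega
    rw [etaMult, if_pos (hd.add_even hc), etaMult, if_pos hd, Nat.add_comm d c,
      jacobiSym_even_add_self hc hd]
    push_cast
    rw [neg_one_pow_eq_zeta, mul_comm (zeta ^ _), mul_assoc, ← zpow_add₀ zeta_ne_zero,
      mul_left_comm, ← zpow_one_add₀ zeta_ne_zero]
    congr 1
    apply zeta_zpow_congr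
    obtain ⟨x, rfl⟩ := hc
    obtain ⟨y, rfl⟩ := hd
    rw [show (x + x) / 2 = x by omega, show (2 * y + 1) / 2 = y by omega]
    push_cast at h ⊢
    have key : (4 : ℤ) ∣ (x : ℤ) * ((2 * b + a) + 3 + 2 * y) := by
      obtain ⟨w, hw⟩ := Int.even_mul_succ_self (x : ℤ)
      have ha : Odd a := by
        rw [← Int.not_even_iff_odd]
        rintro ⟨r, rfl⟩
        have : 2 * (r * (2 * y + 1) - b * x) = 1 := by linarith
        omega
      obtain ⟨r, rfl⟩ := ha
      exact ⟨b * w + x - r * y * x, by linear_combination x * h + 2 * b * hw⟩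
    obtain ⟨t, ht⟩ := twentyfour_dvd_aux key
    exact ⟨t, by linear_combination ht - ((2 * x) ^ 2 - 1) * h⟩

/-- The mirror image of `etaMult_T` for τ ↦ τ/(τ + 1), with the roles of c and d exchanged. -/
lemma etaMult_U {a b : ℤ} {c d : ℕ} (h : a * d - b * c = 1) :
    etaMult (a + b) b (c + d) d = zeta⁻¹ * etaMult a b c d := by
  rw [← zpow_neg_one]
  by_cases hd : Odd d
  · rw [etaMult, etaMult, if_pos hd, if_pos hd, jacobiSym_add_left_self, mul_left_comm,
      ← zpow_add₀ zeta_ne_zero]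
    congr 1
    apply zeta_zpow_congr
    push_cast
    obtain ⟨t, ht⟩ := twentyfour_dvd_of_odd (x := d) (by exact_mod_cast hd)
    exact ⟨-t * (2 * a + b), by linear_combination -(2 * a + b) * ht + (1 - 2 * (1 - d ^ 2)) * h⟩
  · rw [Nat.not_odd_iff_even] at hd
    have hc : Odd c := by
      rw [← Nat.not_even_iff_odd]
      intro hc
      obtain ⟨x, rfl⟩ := hc
      obtain ⟨y, rfl⟩ := hd
      push_cast at h
      have : 2 * (a * y - b * x) = 1 := by linarith
      omega
    rw [etaMult_of_odd (hc.add_even hd), etaMult_of_odd hc, Nat.add_comm c d,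
      jacobiSym_even_add_self hd hc]
    push_cast
    rw [neg_one_pow_eq_zeta, mul_comm (zeta ^ _), mul_assoc, ← zpow_add₀ zeta_ne_zero,
      mul_left_comm, ← zpow_add₀ zeta_ne_zero]
    congr 1
    apply zeta_zpow_congr
    obtain ⟨x, rfl⟩ := hd
    obtain ⟨y, rfl⟩ := hc
    rw [show (x + x) / 2 = x by omega, show (2 * y + 1) / 2 = y by omega]
    push_cast at h ⊢
    have key : (4 : ℤ) ∣ (x : ℤ) * (-(2 * a + b) + 3 + 2 * y) := by
      obtain ⟨w, hw⟩ := Int.even_mul_succ_self (x : ℤ)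
      have hb : Odd b := by
        rw [← Int.not_even_iff_odd]
        rintro ⟨r, rfl⟩
        have : 2 * (a * x - r * (2 * y + 1)) = 1 := by linarith
        omega
      obtain ⟨r, rfl⟩ := hb
      exact ⟨-(a * w) + x + x * y + r * y * x, by linear_combination x * h - 2 * a * hw⟩
    obtain ⟨t, ht⟩ := twentyfour_dvd_aux key
    exact ⟨-t + x * (1 + y), by linear_combination -ht + (1 - 2 * (1 - (2 * x) ^ 2)) * h⟩

/-! ### The transformation formula of eta -/

lemma im_div_add_one_pos {z : ℂ} (hz : 0 < z.im) : 0 < (z / (z + 1)).im := by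
  have hne : z + 1 ≠ 0 := by
    intro h
    have := congrArg Complex.im h
    simp at this
    linarith
  rw [show z / (z + 1) = 1 + -(z + 1)⁻¹ by field_simp; ring]
  simp only [Complex.add_im, Complex.one_im, Complex.neg_im, Complex.inv_im, zero_add]
  rw [neg_div, neg_neg]
  exact div_pos (by simpa using hz) (Complex.normSq_pos.2 hne)

/-- The cocycle relation for cτ + d survives principal square roots without a sign, because c ≥ 0
and d > 0 keep all factors in the closed upper half-plane off the negative axis. -/
lemma sqrt_automorphy_U {c d : ℕ} (hd : 0 < d) {z : ℂ} (hz : 0 < z.im) :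
    Complex.sqrt (((c + d : ℕ) : ℂ) * z + d) =
      Complex.sqrt (c * (z / (z + 1)) + d) * Complex.sqrt (z + 1) := by
  have hz1 : 0 < (z + 1).im := by simpa using hz
  have hne : z + 1 ≠ 0 := by
    rintro h
    simp [h] at hz1
  have hz' := im_div_add_one_pos hz
  have hp : (c * (z / (z + 1)) + d) * (z + 1) = ((c + d : ℕ) : ℂ) * z + d := by
    push_cast
    field_simp
    ring
  have him : (c * (z / (z + 1)) + d : ℂ).im = c * (z / (z + 1)).im := by simp
  have hre : (c * (z / (z + 1)) + d : ℂ).im = 0 → 0 < (c * (z / (z + 1)) + d : ℂ).re := by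
    intro h0
    rw [him] at h0
    have hc : (c : ℝ) = 0 := by
      rcases mul_eq_zero.1 h0 with h | h
      · exact h
      · linarith
    have hc' : c = 0 := by exact_mod_cast hc
    simp [hc', hd]
  rw [← hp]
  refine sqrt_mul_of_im_nonneg ?_ hz1 ?_ ?_ hre
  · intro h
    have h1 := congrArg Complex.im h
    have h2 := hre (by simpa using h1)
    rw [h] at h2
    simp at h2
  · rw [him]
    positivity
  · rw [hp]
    have : (((c + d : ℕ) : ℂ) * z + d).im = (c + d : ℕ) * z.im := by simp
    rw [this]
    positivity

/-- The transformation formula of the Dedekind eta function. -/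
theorem eta_mobius {a b : ℤ} {c d : ℕ} (hd : 0 < d) (h : a * d - b * c = 1) {z : ℂ}
    (hz : 0 < z.im) :
    eta ((a * z + b) / (c * z + d)) = etaMult a b c d * (Complex.sqrt (c * z + d) * eta z) := by
  -- Subtractive Euclidean algorithm on the bottom row: if d ≤ c a factor τ ↦ τ/(τ + 1) is split
  -- off, if c < d a factor τ ↦ τ + 1, and d stays positive. It stops at c = 0, where the matrix is
  -- a translation.
  induction hn : c + d using Nat.strong_induction_on generalizing a b c d z with
  | _ n ih =>
    rcases Nat.eq_zero_or_pos c with rfl | hc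
    · have had : a * d = 1 := by simpa using h
      have hd1 : d = 1 := by
        have := Int.isUnit_iff.1 (IsUnit.of_mul_eq_one_right _ had)
        omega
      subst hd1
      have ha : a = 1 := by simpa using had
      subst ha
      simp [etaMult, eta_add_int]
    · rcases le_or_gt d c with hdc | hdc
      · obtain ⟨x, rfl⟩ := Nat.exists_eq_add_of_le' hdc
        have h' : (a - b) * d - b * x = 1 := by
          push_cast at h
          linarith
        have hz' := im_div_add_one_pos hz
        have hne : z + 1 ≠ 0 := by
          intro h
          have := congrArg Complex.im h
          simp at this
          linarith
        have := ih (x + d) (by omega) hd h' hz' rfl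
        rw [eta_div_add_one hz] at this
        have e1 : (a * z + b) / (((x + d : ℕ) : ℂ) * z + d) =
            (((a - b : ℤ) : ℂ) * (z / (z + 1)) + b) / (x * (z / (z + 1)) + d) := by
          have e2 : ((a - b : ℤ) : ℂ) * (z / (z + 1)) + b = (a * z + b) / (z + 1) := by
            push_cast
            field_simp
            ring
          have e3 : (x : ℂ) * (z / (z + 1)) + d = (((x + d : ℕ) : ℂ) * z + d) / (z + 1) := by
            push_cast
            field_simp
            ring
          rw [e2, e3, div_div_div_cancel_right₀ hne]
        rw [e1, this, sqrt_automorphy_U hd hz]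
        have e4 := etaMult_U h'
        rw [sub_add_cancel] at e4
        rw [e4]
        ring
      · obtain ⟨x, rfl⟩ := Nat.exists_eq_add_of_le' hdc.le
        have h' : a * x - (b - a) * c = 1 := by
          push_cast at h
          linarith
        have := ih (c + x) (by omega) (by omega) h' (z := z + 1) (by simpa using hz) rfl
        rw [eta_add_one] at this
        have e1 : (a * z + b) / ((c : ℂ) * z + ((x + c : ℕ) : ℂ)) =
            (a * (z + 1) + ((b - a : ℤ) : ℂ)) / (c * (z + 1) + x) := by
          push_cast
          congr 1 <;> ring
        have e4 := etaMult_T h'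
        rw [sub_add_cancel] at e4
        rw [e1, this, e4, show (c : ℂ) * z + ((x + c : ℕ) : ℂ) = c * (z + 1) + x by push_cast; ring]
        ring

/-! ### Conjugation by τ ↦ mτ + k/h -/

lemma jacobiSym_add_two_mul_self {s d : ℕ} (hd : Odd d) :
    J(s | d + 2 * s) = (-1) ^ (s * (s - 1) / 2) * J(s | d) := by
  rcases Nat.even_or_odd s with hs | hs
  · rw [show d + 2 * s = s + (s + d) by ring, jacobiSym_even_add_self hs (hs.add_odd hd),
      jacobiSym_even_add_self hs hd, ← mul_assoc, ← pow_add]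
    congr 1
    obtain ⟨x, rfl⟩ := hs
    obtain ⟨y, rfl⟩ := hd
    rw [show (x + x) / 2 = x by omega, show (2 * y + 1) / 2 = y by omega,
      show (x + x + (2 * y + 1)) / 2 = x + y by omega,
      show (x + x) * (x + x - 1) / 2 = x * (x + x - 1) by
        rw [← two_mul, mul_assoc, Nat.mul_div_cancel_left _ two_pos]]
    rcases Nat.eq_zero_or_pos x with rfl | hx
    · simp
    obtain ⟨z, rfl⟩ := Nat.exists_eq_add_of_le' hx
    rw [show z + 1 + (z + 1) - 1 = 2 * z + 1 by omega]
    apply neg_one_pow_congr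
    simp only [Nat.even_mul, Nat.even_add, even_two, Nat.even_add_one]
    tauto
  · have hds : Odd (d + 2 * s) := hd.add_even (even_two_mul s)
    have e : J((d + 2 * s : ℕ) | s) = J(d | s) := by
      apply jacobiSym.mod_left'
      push_cast
      simp
    rw [jacobiSym.quadratic_reciprocity hs hds, jacobiSym.quadratic_reciprocity hs hd, e,
      ← mul_assoc, ← pow_add]
    congr 1
    obtain ⟨x, rfl⟩ := hs
    obtain ⟨y, rfl⟩ := hd
    rw [show (2 * x + 1) / 2 = x by omega, show (2 * y + 1) / 2 = y by omega,
      show (2 * y + 1 + 2 * (2 * x + 1)) / 2 = y + (2 * x + 1) by omega,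
      show (2 * x + 1) * (2 * x + 1 - 1) / 2 = x * (2 * x + 1) by
        rw [Nat.add_sub_cancel, mul_left_comm, Nat.mul_div_cancel_left _ two_pos, mul_comm]]
    congr 1
    ring

/-- Conjugation turns the lower right entry d into d - khs; with kh = -2t this is exactly the shift
of modulus treated here. -/
lemma jacobiSym_add_two_mul_mul_self {s d : ℕ} (t : ℕ) (hd : Odd d) :
    J(s | d + 2 * t * s) = (-1) ^ (t * (s * (s - 1) / 2)) * J(s | d) := by
  induction t with
  | zero => simp
  | succ t ih =>
    rw [show d + 2 * (t + 1) * s = d + 2 * t * s + 2 * s by ring,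
      jacobiSym_add_two_mul_self (hd.add_even (by rw [mul_assoc]; exact even_two_mul _)), ih,
      ← mul_assoc, ← pow_add]
    congr 2
    ring

section Congruence

variable {a b d x h k s m g : ℤ}

/-- Here and in the two lemmas modulo 8, the exponent of the multiplier at the conjugated matrix,
corrected by the sign of the Jacobi symbol, is compared with the simplified exponent. Only squares
of h, d and g matter, and squares of units are 1 modulo 3 and modulo 8. -/
lemma mod_three_congr (hd : ¬ (3 : ℤ) ∣ d) (h1 : a * d - b * (h ^ 2 * m * s) = 1)
    (hcase : (3 ∣ h ∧ (3 : ℤ) ∣ g ^ 2 - k ^ 2) ∨ (3 ∣ k ∧ ¬ 3 ∣ h ∧ ¬ (3 : ℤ) ∣ g)) :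
    (3 : ℤ) ∣ ((a + k * h * s + (d - k * h * s)) * (h ^ 2 * s) -
      (m * b + k * x - k ^ 2 * s) * (d - k * h * s) * ((h ^ 2 * s) ^ 2 - 1) +
      3 * (d - k * h * s) - 3 - 3 * (h ^ 2 * s) * (d - k * h * s)) - 3 * k * h * (s * (s - 1)) -
      (m * b * d + k * (d * x + b * h * m * s) - d * s * g ^ 2 + 3 * (d - 1)) := by
  have sq : ∀ y : ZMod 3, y ≠ 0 → y ^ 2 = 1 := by decide
  have ne : ∀ y : ℤ, ¬ (3 : ℤ) ∣ y → (y : ZMod 3) ≠ 0 := fun y hy h0 =>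
    hy ((ZMod.intCast_zmod_eq_zero_iff_dvd y 3).1 h0)
  have hd' := sq _ (ne d hd)
  have h1' := congrArg (Int.cast : ℤ → ZMod 3) h1
  apply (ZMod.intCast_zmod_eq_zero_iff_dvd _ 3).1
  push_cast at h1' ⊢
  rcases hcase with ⟨hh, hg⟩ | ⟨hk, hh, hg⟩
  · have hh' := (ZMod.intCast_zmod_eq_zero_iff_dvd h 3).2 hh
    have hg' := (ZMod.intCast_zmod_eq_zero_iff_dvd _ 3).2 hg
    push_cast at hg'
    rw [hh']
    linear_combination (d * s : ZMod 3) * hg'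
  · have hk' := (ZMod.intCast_zmod_eq_zero_iff_dvd k 3).2 hk
    have hg' := sq _ (ne g hg)
    have hh' := sq _ (ne h hh)
    rw [hh'] at h1' ⊢
    rw [hg', hk']
    linear_combination (d * s : ZMod 3) * h1' - (a * s : ZMod 3) * hd'

lemma mod_eight_congr_of_odd (hd : Odd d) (h1 : a * d - b * (h ^ 2 * m * s) = 1)
    (hh : Odd h) (hg : Odd g) (hk : 8 ∣ k) :
    (8 : ℤ) ∣ ((a + k * h * s + (d - k * h * s)) * (h ^ 2 * s) -
      (m * b + k * x - k ^ 2 * s) * (d - k * h * s) * ((h ^ 2 * s) ^ 2 - 1) +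
      3 * (d - k * h * s) - 3 - 3 * (h ^ 2 * s) * (d - k * h * s)) - 3 * k * h * (s * (s - 1)) -
      (m * b * d + k * (d * x + b * h * m * s) - d * s * g ^ 2 + 3 * (d - 1)) := by
  have sq : ∀ y : ℤ, Odd y → (y : ZMod 8) ^ 2 = 1 := fun y hy => by
    have := (ZMod.intCast_zmod_eq_zero_iff_dvd _ 8).2 (Int.eight_dvd_sq_sub_one_of_odd hy)
    push_cast at this
    exact sub_eq_zero.1 this
  have hd' := sq _ hd
  have hg' := sq _ hg
  have hh' := sq _ hh
  have hk' := (ZMod.intCast_zmod_eq_zero_iff_dvd k 8).2 hk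
  have h1' := congrArg (Int.cast : ℤ → ZMod 8) h1
  apply (ZMod.intCast_zmod_eq_zero_iff_dvd _ 8).1
  push_cast at h1' ⊢
  rw [hh'] at h1' ⊢
  rw [hg', hk']
  linear_combination (d * s : ZMod 8) * h1' - (a * s : ZMod 8) * hd'

lemma mod_eight_congr_of_even (hd : Odd d) (h1 : a * d - b * ((2 * h) ^ 2 * m * s) = 1)
    (hx : 2 * h * x = d - a)
    (hg : ((Odd k ∨ Even h) ∧ (8 : ℤ) ∣ g ^ 2 - k ^ 2) ∨ (Even k ∧ Odd h ∧ (8 : ℤ) ∣ g ^ 2 - 4)) :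
    (8 : ℤ) ∣ ((a + k * (2 * h) * s + (d - k * (2 * h) * s)) * ((2 * h) ^ 2 * s) -
      (m * b + k * x - k ^ 2 * s) * (d - k * (2 * h) * s) * (((2 * h) ^ 2 * s) ^ 2 - 1) +
      3 * (d - k * (2 * h) * s) - 3 - 3 * ((2 * h) ^ 2 * s) * (d - k * (2 * h) * s)) -
      3 * k * (2 * h) * (s * (s - 1)) -
      (m * b * d + k * (d * x + b * (2 * h) * m * s) - d * s * g ^ 2 + 3 * (d - 1)) := by
  have sq : ∀ y : ℤ, Odd y → (y : ZMod 8) ^ 2 = 1 := fun y hy => by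
    have := (ZMod.intCast_zmod_eq_zero_iff_dvd _ 8).2 (Int.eight_dvd_sq_sub_one_of_odd hy)
    push_cast at this
    exact sub_eq_zero.1 this
  have h8 : (8 : ZMod 8) = 0 := rfl
  have four : ∀ y : ℤ, Even y → 4 * (y : ZMod 8) = 0 := by
    rintro _ ⟨y, rfl⟩
    push_cast
    linear_combination (y : ZMod 8) * h8
  have foursq : ∀ y : ZMod 8, 4 * y ^ 2 = 4 * y := by decide
  have hd2 := sq _ hd
  have hd4 : 4 * (d : ZMod 8) = 4 := by
    have := four (d - 1) (hd.sub_odd odd_one)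
    push_cast at this
    linear_combination this
  have ha : Odd a := by
    have : Odd (a * d) := by
      rw [show a * d = 2 * (b * (2 * h ^ 2 * m * s)) + 1 by linear_combination h1]
      exact odd_two_mul_add_one _
    exact (Int.odd_mul.1 this).1
  have had := four _ (ha.add_odd hd)
  have hx' := congrArg (Int.cast : ℤ → ZMod 8) hx
  have h1' := congrArg (Int.cast : ℤ → ZMod 8) h1
  -- All dependence on gcd(2h, k) and on the parities of h and k sits in this relation; the rest
  -- follows from d² = 1, 4d = 4 and 4y² = 4y modulo 8.
  have main : 4 * (h : ZMod 8) * s + 2 * k * h * s ^ 2 * (k ^ 2 - 3) + d * s * (g ^ 2 - k ^ 2) = 0 := by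
    have hs := foursq s
    rcases hg with ⟨hc, hg⟩ | ⟨hk, hh, hg⟩
    · have hg' := (ZMod.intCast_zmod_eq_zero_iff_dvd _ 8).2 hg
      push_cast at hg'
      rcases Int.even_or_odd k with hk | hk
      · have hh := four h (hc.resolve_left (Int.not_odd_iff_even.2 hk))
        obtain ⟨r, rfl⟩ := hk
        push_cast at hg' ⊢
        linear_combination (d * s : ZMod 8) * hg' + (s + r * s ^ 2 * ((r + r) ^ 2 - 3) : ZMod 8) * hh
      · have hk4 : 4 * (k : ZMod 8) = 4 := by
          have := four (k - 1) (hk.sub_odd odd_one)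
          push_cast at this
          linear_combination this
        linear_combination (d * s : ZMod 8) * hg' + (2 * k * h * s ^ 2 : ZMod 8) * sq _ hk -
          (h * s ^ 2 : ZMod 8) * hk4 - (h : ZMod 8) * hs
    · have hg' := (ZMod.intCast_zmod_eq_zero_iff_dvd _ 8).2 hg
      have hh4 : 4 * (h : ZMod 8) = 4 := by
        have := four (h - 1) (hh.sub_odd odd_one)
        push_cast at this
        linear_combination this
      obtain ⟨r, rfl⟩ := hk
      have hr := foursq r
      push_cast at hg' ⊢
      linear_combination (d * s : ZMod 8) * hg' +
        (s + r * s ^ 2 * ((r + r) ^ 2 - 3) : ZMod 8) * hh4 + (s - s * r ^ 2 : ZMod 8) * hd4 +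
        r * hs - (s : ZMod 8) * hr + (s - 2 * s ^ 2 * r + 2 * s ^ 2 * r ^ 3 : ZMod 8) * h8
  apply (ZMod.intCast_zmod_eq_zero_iff_dvd _ 8).1
  push_cast at h1' hx' had ⊢
  have hda : (d : ZMod 8) - a = 4 * b * h ^ 2 * m * s := by
    linear_combination (-d : ZMod 8) * h1' + (a : ZMod 8) * hd2 -
      (b * h ^ 2 * m * s : ZMod 8) * hd4 - (b * h ^ 2 * m * s : ZMod 8) * h8
  have hp := foursq (k * h * s)
  have hh := foursq h
  linear_combination main + (h ^ 2 * s : ZMod 8) * had + (h ^ 2 * s : ZMod 8) * hd4 +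
    (s : ZMod 8) * hh - (k ^ 2 * s : ZMod 8) * hx' - (k ^ 2 * s : ZMod 8) * hda - (b * m : ZMod 8) * hp +
    (-(k * h * s * m * b) + 3 * k * h ^ 3 * s ^ 2 - 2 * k * h ^ 4 * s ^ 2 * d * x +
      4 * k * h ^ 5 * s ^ 3 * m * b + 2 * k ^ 2 * h ^ 4 * s ^ 3 * d + 4 * k ^ 2 * h ^ 5 * s ^ 3 * x -
      4 * k ^ 3 * h ^ 5 * s ^ 4 - 2 * h ^ 2 * s * d - 2 * h ^ 4 * s ^ 2 * d * m * b : ZMod 8) * h8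

end Congruence

lemma three_dvd_gcd_sq_sub {h k : ℤ} (hh : (3 : ℤ) ∣ h) :
    (3 : ℤ) ∣ (Int.gcd h k : ℤ) ^ 2 - k ^ 2 := by
  have key : ∀ y : ZMod 3, y ≠ 0 → y ^ 2 = 1 := by decide
  have hiff : (3 : ℤ) ∣ (Int.gcd h k : ℤ) ↔ (3 : ℤ) ∣ k := by
    rw [Int.dvd_coe_gcd_iff]
    tauto
  apply (ZMod.intCast_zmod_eq_zero_iff_dvd _ 3).1
  by_cases hk : (3 : ℤ) ∣ k
  · have h1 := (ZMod.intCast_zmod_eq_zero_iff_dvd _ 3).2 hk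
    have h2 := (ZMod.intCast_zmod_eq_zero_iff_dvd _ 3).2 (hiff.2 hk)
    rw [Int.cast_sub, Int.cast_pow, Int.cast_pow, h1, h2, sub_self]
  · have h1 := key _ (fun h0 => hk ((ZMod.intCast_zmod_eq_zero_iff_dvd k 3).1 h0))
    have h2 := key _ (fun h0 => hk (hiff.1 ((ZMod.intCast_zmod_eq_zero_iff_dvd _ 3).1 h0)))
    rw [Int.cast_sub, Int.cast_pow, Int.cast_pow, h1, h2, sub_self]

lemma eight_dvd_sq_sub_sq_of_odd {x y : ℤ} (hx : Odd x) (hy : Odd y) : (8 : ℤ) ∣ x ^ 2 - y ^ 2 := by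
  have h1 := Int.eight_dvd_sq_sub_one_of_odd hx
  have h2 := Int.eight_dvd_sq_sub_one_of_odd hy
  omega

lemma eight_dvd_sq_sub_four {x : ℤ} (hx : (2 : ℤ) ∣ x) (hx4 : ¬ (4 : ℤ) ∣ x) :
    (8 : ℤ) ∣ x ^ 2 - 4 := by
  obtain ⟨y, rfl⟩ := hx
  have hy : Odd y := by
    rw [← Int.not_even_iff_odd]
    rintro ⟨z, rfl⟩
    exact hx4 ⟨z, by ring⟩
  obtain ⟨w, hw⟩ := Int.eight_dvd_sq_sub_one_of_odd hy
  exact ⟨4 * w, by linear_combination 4 * hw⟩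

lemma eight_dvd_gcd_sq_cases (h k : ℤ) :
    ((Odd k ∨ Even h) ∧ (8 : ℤ) ∣ (Int.gcd (2 * h) k : ℤ) ^ 2 - k ^ 2) ∨
      (Even k ∧ Odd h ∧ (8 : ℤ) ∣ (Int.gcd (2 * h) k : ℤ) ^ 2 - 4) := by
  have h2 : (2 : ℤ) ∣ (Int.gcd (2 * h) k : ℤ) ↔ (2 : ℤ) ∣ k := by
    rw [Int.dvd_coe_gcd_iff]
    simp
  have h4 : (4 : ℤ) ∣ (Int.gcd (2 * h) k : ℤ) ↔ (4 : ℤ) ∣ 2 * h ∧ (4 : ℤ) ∣ k :=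
    Int.dvd_coe_gcd_iff
  rcases Int.even_or_odd k with hk | hk
  · rcases Int.even_or_odd h with hh | hh
    · refine Or.inl ⟨Or.inr hh, ?_⟩
      have hh4 : (4 : ℤ) ∣ 2 * h := by
        obtain ⟨r, rfl⟩ := hh
        exact ⟨r, by ring⟩
      by_cases hk4 : (4 : ℤ) ∣ k
      · obtain ⟨r, hr⟩ := h4.2 ⟨hh4, hk4⟩
        obtain ⟨r', hr'⟩ := hk4
        exact ⟨2 * r ^ 2 - 2 * r' ^ 2, by rw [hr, hr']; ring⟩
      · have e1 := eight_dvd_sq_sub_four (h2.2 hk.two_dvd) (fun h0 => hk4 (h4.1 h0).2)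
        have e2 := eight_dvd_sq_sub_four hk.two_dvd hk4
        omega
    · refine Or.inr ⟨hk, hh, eight_dvd_sq_sub_four (h2.2 hk.two_dvd) fun h0 => ?_⟩
      obtain ⟨r, hr⟩ := (h4.1 h0).1
      obtain ⟨r', hr'⟩ := hh
      omega
  · refine Or.inl ⟨Or.inl hk, eight_dvd_sq_sub_sq_of_odd ?_ hk⟩
    rw [← Int.not_even_iff_odd] at hk ⊢
    exact fun h0 => hk (even_iff_two_dvd.2 (h2.1 h0.two_dvd))

/-- The eta multiplier at a matrix of `Γ₀(h²m)`, conjugated by `τ ↦ m τ + k / h`. -/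
lemma etaMult_conj {a b x k : ℤ} {h m s d t : ℕ} (hd : Odd d) (hd3 : ¬ 3 ∣ d)
    (h1 : a * d - b * (h ^ 2 * m * s) = 1) (hx : h * x = d - a) (hk : k * h = -(2 * t))
    (hk2 : Even h ∨ 8 ∣ k) (hk3 : 3 ∣ h ∨ 3 ∣ k) :
    etaMult (a + k * h * s) (m * b + k * x - k ^ 2 * s) (h ^ 2 * s) (d + 2 * t * s) =
      J(s | d) * zeta ^ (m * b * d + k * (d * x + b * h * m * s) -
        d * s * (Int.gcd h k : ℤ) ^ 2 + 3 * (d - 1) : ℤ) := by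
  have hd' : Odd (d + 2 * t * s) := hd.add_even (by rw [mul_assoc]; exact even_two_mul _)
  -- The conjugated matrix has determinant 1 and lower left entry h²s, so h is prime to its lower
  -- right entry and h² drops out of the symbol.
  have hcop : (h : ℤ).gcd (d + 2 * t * s : ℕ) = 1 := by
    rw [← Int.isCoprime_iff_gcd_eq_one]
    refine ⟨-(m * b + k * x - k ^ 2 * s) * (h * s), a + k * h * s, ?_⟩
    push_cast
    linear_combination h1 + (a * s + k * h * s ^ 2) * hk - k * h * s * hx
  rw [etaMult, if_pos hd']
  have hJ : J((h ^ 2 * s : ℕ) | d + 2 * t * s) = (-1) ^ (t * (s * (s - 1) / 2)) * J(s | d) := by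
    push_cast
    rw [jacobiSym.mul_left, jacobiSym.sq_one' hcop, one_mul, jacobiSym_add_two_mul_mul_self t hd]
  rw [hJ]
  push_cast
  rw [neg_one_pow_eq_zeta, mul_comm (zeta ^ _), mul_assoc, ← zpow_add₀ zeta_ne_zero]
  congr 1
  apply zeta_zpow_congr
  -- The sign of the symbol as a power of ζ: -1 = ζ¹² and 2t = -kh.
  have hs : 12 * ((t * (s * (s - 1) / 2) : ℕ) : ℤ) = -(3 * k * h * (s * (s - 1))) := by
    have : ((s * (s - 1) / 2 : ℕ) : ℤ) * 2 = s * (s - 1) := by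
      rcases Nat.eq_zero_or_pos s with rfl | hs
      · simp
      · have e := Nat.div_mul_cancel (Nat.even_mul_pred_self s).two_dvd
        have e' := congrArg (Nat.cast : ℕ → ℤ) e
        push_cast [Nat.cast_sub hs] at e' ⊢
        exact e'
    rw [Nat.cast_mul]
    linear_combination 6 * (t : ℤ) * this + 3 * (s * (s - 1) : ℤ) * hk
  have hdt : (d : ℤ) + 2 * t * s = d - k * h * s := by linear_combination (s : ℤ) * hk
  have hd3' : ¬ (3 : ℤ) ∣ d := by exact_mod_cast hd3
  rw [hs, hdt]
  have m3 := mod_three_congr (a := a) (b := b) (d := d) (x := x) (h := h) (k := k) (s := s)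
    (m := m) (g := Int.gcd h k) hd3' h1 (by
      by_cases hh : (3 : ℤ) ∣ h
      · exact Or.inl ⟨hh, three_dvd_gcd_sq_sub hh⟩
      · refine Or.inr ⟨hk3.resolve_left (by exact_mod_cast hh), hh, fun h0 => hh ?_⟩
        exact h0.trans (Int.gcd_dvd_left _ _))
  have m8 : (8 : ℤ) ∣ ((a + k * h * s + (d - k * h * s)) * (h ^ 2 * s) -
      (m * b + k * x - k ^ 2 * s) * (d - k * h * s) * ((h ^ 2 * s) ^ 2 - 1) +
      3 * (d - k * h * s) - 3 - 3 * (h ^ 2 * s) * (d - k * h * s)) - 3 * k * h * (s * (s - 1)) -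
      (m * b * d + k * (d * x + b * h * m * s) - d * s * (Int.gcd h k : ℤ) ^ 2 + 3 * (d - 1)) := by
    have hdz : Odd (d : ℤ) := by exact_mod_cast hd
    rcases Nat.even_or_odd h with hh | hh
    · obtain ⟨r, rfl⟩ := hh
      push_cast at h1 hx ⊢
      rw [← two_mul] at h1 hx ⊢
      exact mod_eight_congr_of_even hdz h1 hx (eight_dvd_gcd_sq_cases _ _)
    · have hhz : Odd (h : ℤ) := by exact_mod_cast hh
      refine mod_eight_congr_of_odd hdz h1 hhz ?_ (hk2.resolve_left (Nat.not_even_iff_odd.2 hh))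
      rw [← Int.not_even_iff_odd] at hhz ⊢
      exact fun h0 => hhz (h0.trans_dvd (Int.gcd_dvd_left _ _))
  generalize (a + k * h * s + (d - k * h * s)) * (h ^ 2 * s) -
      (m * b + k * x - k ^ 2 * s) * (d - k * h * s) * ((h ^ 2 * s) ^ 2 - 1) +
      3 * (d - k * h * s) - 3 - 3 * (h ^ 2 * s) * (d - k * h * s) = A at *
  generalize (m * b * d + k * (d * x + b * h * m * s) - d * s * (Int.gcd h k : ℤ) ^ 2 +
    3 * (d - 1)) = B at *
  generalize 3 * k * h * (s * (s - 1)) = C at *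
  omega

lemma eta_conj_of_good {a b x k : ℤ} {h m s d t : ℕ} (hh : 0 < h) (hm : 0 < m) (hd : Odd d)
    (hd3 : ¬ 3 ∣ d) (h1 : a * d - b * (h ^ 2 * m * s) = 1) (hx : h * x = d - a)
    (hk : k * h = -(2 * t)) (hk2 : Even h ∨ 8 ∣ k) (hk3 : 3 ∣ h ∨ 3 ∣ k) {z : ℂ} (hz : 0 < z.im) :
    eta (m * ((a * z + b) / ((h ^ 2 * m * s : ℕ) * z + d)) + k / h) =
      J(s | d) * zeta ^ (m * b * d + k * (d * x + b * h * m * s) -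
        d * s * (Int.gcd h k : ℤ) ^ 2 + 3 * (d - 1) : ℤ) *
      (Complex.sqrt ((h ^ 2 * m * s : ℕ) * z + d) * eta (m * z + k / h)) := by
  have hh' : (h : ℂ) ≠ 0 := by exact_mod_cast hh.ne'
  have hw : 0 < (m * z + k / h : ℂ).im := by
    have : ((k : ℂ) / h).im = 0 := by
      rw [show (k : ℂ) / h = ((k / h : ℝ) : ℂ) by push_cast; rfl, Complex.ofReal_im]
    simp only [Complex.add_im, this, Complex.mul_im, Complex.natCast_re, Complex.natCast_im]
    have : (0 : ℝ) < m := by exact_mod_cast hm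
    nlinarith
  have hdp : 0 < d := hd.pos
  have hkC : (k : ℂ) * h = -(2 * t) := by exact_mod_cast hk
  have hxC : (h : ℂ) * x = d - a := by exact_mod_cast hx
  have hden : ((h ^ 2 * s : ℕ) : ℂ) * (m * z + k / h) + (d + 2 * t * s : ℕ) =
      (h ^ 2 * m * s : ℕ) * z + d := by
    push_cast
    field_simp
    linear_combination (s : ℂ) * hkC
  have hne : ((h ^ 2 * m * s : ℕ) : ℂ) * z + d ≠ 0 := by
    intro h0
    have e1 := congrArg Complex.im h0
    have e2 := congrArg Complex.re h0
    simp only [Complex.add_im, Complex.add_re, Complex.mul_im, Complex.mul_re, Complex.natCast_re,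
      Complex.natCast_im, Complex.zero_im, Complex.zero_re, zero_mul, add_zero, sub_zero] at e1 e2
    rcases mul_eq_zero.1 e1 with h2 | h2
    · rw [h2] at e2
      have : (d : ℝ) = 0 := by linarith
      exact hdp.ne' (by exact_mod_cast this)
    · exact hz.ne' h2
  have hnum : ((a + k * h * s : ℤ) : ℂ) * (m * z + k / h) + (m * b + k * x - k ^ 2 * s : ℤ) =
      m * (a * z + b) + k / h * ((h ^ 2 * m * s : ℕ) * z + d) := by
    push_cast
    field_simp
    linear_combination (k : ℂ) * hxC
  have key := eta_mobius (a := a + k * h * s) (b := m * b + k * x - k ^ 2 * s) (c := h ^ 2 * s)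
    (d := d + 2 * t * s) (by omega) (by
      push_cast
      linear_combination h1 + (a * s + k * h * s ^ 2) * hk - k * h * s * hx) hw
  rw [hden, hnum, etaMult_conj hd hd3 h1 hx hk hk2 hk3] at key
  rw [← key]
  congr 1
  symm
  rw [add_div, mul_div_cancel_right₀ _ hne, mul_div_assoc]

/-- Changing k by a multiple of h only translates the argument of η by an integer. So k may be moved
to a representative that is divisible by q, the part of 24 prime to h, and has kh even and
nonpositive. -/
lemma exists_good_shift {h : ℕ} (hh : 0 < h) (k : ℤ) : ∃ (j : ℤ) (t : ℕ),
    (k + h * j) * h = -(2 * t) ∧ (Even h ∨ 8 ∣ k + h * j) ∧ (3 ∣ h ∨ 3 ∣ k + h * j) := by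
  obtain ⟨q, hq, hcop, hq2, hq3⟩ : ∃ q : ℕ, 0 < q ∧ IsCoprime (h : ℤ) q ∧
      (Even h ∨ (8 : ℤ) ∣ q) ∧ (3 ∣ h ∨ (3 : ℤ) ∣ q) := by
    have c2 : Odd h → IsCoprime (h : ℤ) 8 := fun ho => by
      rw [show (8 : ℤ) = 2 ^ 3 by norm_num]
      refine IsCoprime.pow_right ?_
      exact_mod_cast (Nat.isCoprime_iff_coprime.2 ho.coprime_two_right)
    have c3 : ¬ 3 ∣ h → IsCoprime (h : ℤ) 3 := fun ho => by
      exact_mod_cast Nat.isCoprime_iff_coprime.2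
        ((Nat.prime_three.coprime_iff_not_dvd.2 ho).symm)
    rcases Nat.even_or_odd h with h2 | h2 <;> by_cases h3 : 3 ∣ h
    · exact ⟨1, one_pos, by simpa using isCoprime_one_right, Or.inl h2, Or.inl h3⟩
    · exact ⟨3, by norm_num, c3 h3, Or.inl h2, Or.inr (by norm_num)⟩
    · exact ⟨8, by norm_num, c2 h2, Or.inr (by norm_num), Or.inl h3⟩
    · exact ⟨24, by norm_num, by simpa using (c2 h2).mul_right (c3 h3), Or.inr (by norm_num),
        Or.inr (by norm_num)⟩
  obtain ⟨u, v, huv⟩ := hcop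
  -- `k - k u h = k v q` is divisible by `q`; subtract a large multiple of `2 h q`.
  set A : ℤ := |k * v| with hA
  have e : k + h * (-(k * u) - 2 * q * A) = q * (k * v - 2 * h * A) := by
    linear_combination (-k) * huv
  have hev : Even h ∨ Even q := by
    rcases hq2 with h2 | h2
    · exact Or.inl h2
    · exact Or.inr (even_iff_two_dvd.2 (by omega))
  have hle : k * v - 2 * h * A ≤ 0 := by
    have : k * v ≤ A := le_abs_self _
    have hA0 : 0 ≤ A := abs_nonneg _
    have : (1 : ℤ) ≤ h := by exact_mod_cast hh
    nlinarith
  have hodd : ∃ r : ℤ, (q : ℤ) * (k * v - 2 * h * A) * h = 2 * r := by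
    rcases hev with ⟨r, hr⟩ | ⟨r, hr⟩
    · exact ⟨q * (k * v - 2 * h * A) * r, by rw [hr]; push_cast; ring⟩
    · exact ⟨r * (k * v - 2 * h * A) * h, by rw [hr]; push_cast; ring⟩
  obtain ⟨r, hr⟩ := hodd
  have hr0 : r ≤ 0 := by
    have : (q : ℤ) * (k * v - 2 * h * A) * h ≤ 0 :=
      mul_nonpos_of_nonpos_of_nonneg (mul_nonpos_of_nonneg_of_nonpos (by positivity) hle)
        (by positivity)
    linarith
  refine ⟨-(k * u) - 2 * q * A, (-r).toNat, ?_, ?_, ?_⟩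
  · rw [e, hr, Int.toNat_of_nonneg (by linarith)]
    ring
  · rw [e]
    exact hq2.imp_right fun h2 => h2.mul_right _
  · rw [e]
    exact hq3.imp_right fun h2 => h2.mul_right _

/-- The transformation formula for `η(m τ + k / h)` under `Γ₀(h²m)`. -/
theorem eta_conj {a b y : ℤ} (k : ℤ) {h m s d : ℕ} (hh : 0 < h) (hm : 0 < m)
    (hd : Odd d) (hd3 : ¬ 3 ∣ d) (h1 : a * d - b * (h ^ 2 * m * s) = 1)
    (hy : h * y = d ^ 2 - 1) {z : ℂ} (hz : 0 < z.im) :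
    eta (m * ((a * z + b) / ((h ^ 2 * m * s : ℕ) * z + d)) + k / h) =
      J(s | d) * zeta ^ (m * b * d + k * y - d * s * (Int.gcd h k : ℤ) ^ 2 + 3 * (d - 1) : ℤ) *
      (Complex.sqrt ((h ^ 2 * m * s : ℕ) * z + d) * eta (m * z + k / h)) := by
  obtain ⟨j, t, ht, hk2, hk3⟩ := exists_good_shift hh k
  have hh' : (h : ℂ) ≠ 0 := by exact_mod_cast hh.ne'
  -- This solves dx + bhms = y for x, using ad = 1 + bc with c = h²ms; it is the integer (d - a)/h.
  set x : ℤ := a * (y - b * h * m * s) - b * h * m * s * (d - a) with hxdef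
  have hx : h * x = d - a := by
    rw [hxdef]
    linear_combination a * hy + (d - a) * h1 + a * h1
  have hdx : d * x + b * h * m * s = y := by
    have : (h : ℤ) ≠ 0 := by exact_mod_cast hh.ne'
    apply mul_left_cancel₀ this
    linear_combination d * hx - hy - h1
  have key := eta_conj_of_good hh hm hd hd3 h1 hx ht hk2 hk3 hz
  have e1 : ∀ w : ℂ, w + ((k + h * j : ℤ) : ℂ) / h = w + k / h + j := by
    intro w
    push_cast
    field_simp
    ring
  rw [e1, e1, eta_add_int, eta_add_int, hdx, Int.gcd_add_mul_left_right] at key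
  have hd24 : (24 : ℤ) ∣ (d : ℤ) ^ 2 - 1 := by
    have h8 := Int.eight_dvd_sq_sub_one_of_odd (k := (d : ℤ)) (by exact_mod_cast hd)
    have h3 : (3 : ℤ) ∣ (d : ℤ) ^ 2 - 1 := by
      have : (d : ℤ) % 3 = 1 ∨ (d : ℤ) % 3 = 2 := by omega
      apply Int.dvd_of_emod_eq_zero
      rcases this with h | h <;> simp [pow_two, Int.mul_emod, Int.sub_emod, h]
    omega
  -- Undoing the shift changes the exponent by jhy = j(d² - 1), a multiple of 24.
  have e2 : zeta ^ (m * b * d + (k + h * j) * y - d * s * (Int.gcd h k : ℤ) ^ 2 + 3 * (d - 1) : ℤ) =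
      zeta ^ (m * b * d + k * y - d * s * (Int.gcd h k : ℤ) ^ 2 + 3 * (d - 1) : ℤ) := by
    apply zeta_zpow_congr
    obtain ⟨r, hr⟩ := hd24
    exact ⟨j * r, by linear_combination j * hy + j * hr⟩
  rw [e2] at key
  have hz0 : zeta ^ j ≠ 0 := zpow_ne_zero _ zeta_ne_zero
  apply mul_left_cancel₀ hz0
  rw [key]
  ring

/-! ### Eta products under Γ₀(N) -/

lemma prod_zpow_eq_zpow_sum {ι G : Type*} [CommGroupWithZero G] {x : G} (hx : x ≠ 0) (s : Finset ι)
    (f : ι → ℤ) : ∏ i ∈ s, x ^ f i = x ^ ∑ i ∈ s, f i := by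
  classical
  induction s using Finset.induction_on with
  | empty => simp
  | insert i s hi ih => rw [Finset.prod_insert hi, Finset.sum_insert hi, ih, zpow_add₀ hx]

lemma mem_pairs {N : ℕ} (hN : N ≠ 0) {p : Σ _ : ℕ, ℕ} (hp : p ∈ pairs N) :
    0 < p.1 ∧ p.1 ∣ N ∧ 0 < h N p.1 ∧ p.1 * h N p.1 ^ 2 ∣ N ∧ p.2 < h N p.1 := by
  simp only [pairs, Finset.mem_sigma, Nat.mem_divisors, Finset.mem_range] at hp
  exact ⟨Nat.pos_of_dvd_of_pos hp.1.1 (Nat.pos_of_ne_zero hN), hp.1.1, by omega,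
    (isGreatest_h hN hp.1.1).1, hp.2⟩

/-- At each prime 2v(h) ≤ 2v(n) + 1, since M is squarefree, hence v(h) ≤ v(n). This is what brings
the hypothesis n ∣ 24 to bear on every h(m). -/
lemma h_dvd {n M N m : ℕ} (hM : Squarefree M) (hN : N = n ^ 2 * M) (hN0 : N ≠ 0) (hm : m ∣ N) :
    h N m ∣ n := by
  have h1 : h N m ^ 2 ∣ n ^ 2 * M := hN ▸ (Dvd.intro_left m rfl).trans (isGreatest_h hN0 hm).1
  by_contra hcon
  have hn0 : n ≠ 0 := by rintro rfl; simp at hN; exact hN0 hN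
  have hM0 : M ≠ 0 := hM.ne_zero
  have hh0 : h N m ≠ 0 := by
    intro h0
    have := (isGreatest_h hN0 hm).1
    simp [h0] at this
    exact hN0 this
  rw [← Nat.factorization_le_iff_dvd hh0 hn0, Finsupp.le_def] at hcon
  push Not at hcon
  obtain ⟨p, hp⟩ := hcon
  have h2 := (Nat.factorization_le_iff_dvd (pow_ne_zero 2 hh0) (mul_ne_zero (pow_ne_zero 2 hn0) hM0)).2 h1 p
  have h3 := hM.natFactorization_le_one p
  rw [Nat.factorization_mul (pow_ne_zero 2 hn0) hM0, Nat.factorization_pow, Nat.factorization_pow] at h2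
  simp at h2
  omega

lemma im_etaMK_arg_pos {m : ℕ} (hm : 0 < m) (k h : ℕ) (τ : ℍ) :
    0 < ((m : ℂ) * τ + (k : ℂ) / (h : ℂ)).im := by
  have : ((k : ℂ) / h).im = 0 := by
    rw [show (k : ℂ) / h = ((k / h : ℝ) : ℂ) by push_cast; rfl, Complex.ofReal_im]
  simp only [Complex.add_im, this, Complex.mul_im, Complex.natCast_re, Complex.natCast_im]
  have h1 : (0 : ℝ) < m := by exact_mod_cast hm
  have h2 := τ.im_pos
  rw [← UpperHalfPlane.coe_im] at h2
  nlinarith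

lemma etaMK_ne_zero {N m : ℕ} (hm : 0 < m) (k : ℕ) (τ : ℍ) : etaMK N m k τ ≠ 0 :=
  eta_ne_zero (im_etaMK_arg_pos hm k _ τ)

lemma etaProduct_ne_zero {N : ℕ} (hN : N ≠ 0) (e : ℕ → ℕ → ℤ) (τ : ℍ) : etaProduct N e τ ≠ 0 :=
  Finset.prod_ne_zero_iff.2 fun _ hp => zpow_ne_zero _ (etaMK_ne_zero (mem_pairs hN hp).1 _ _)

lemma etaProduct_vadd_int (N : ℕ) (e : ℕ → ℕ → ℤ) {τ τ' : ℍ} (j : ℤ) (hτ : (τ' : ℂ) = τ + j) :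
    etaProduct N e τ' = zeta ^ (j * ∑ p ∈ pairs N, e p.1 p.2 * (p.1 : ℤ)) * etaProduct N e τ := by
  rw [etaProduct, etaProduct, Finset.mul_sum, ← prod_zpow_eq_zpow_sum zeta_ne_zero,
    ← Finset.prod_mul_distrib]
  refine Finset.prod_congr rfl fun p hp => ?_
  rw [etaMK, hτ, show (p.1 : ℂ) * (τ + j) + (p.2 : ℂ) / (h N p.1 : ℂ) =
    (p.1 : ℂ) * τ + (p.2 : ℂ) / (h N p.1 : ℂ) + ((j * p.1 : ℤ) : ℂ) by push_cast; ring, eta_add_int,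
    mul_zpow, ← zpow_mul, etaMK]
  congr 2
  ring

/-- The integer `N / (m h²)` attached to a divisor `m` of `N`. -/
def cofactor (N m : ℕ) : ℕ := N / (m * h N m ^ 2)

lemma cofactor_mul {N : ℕ} (hN : N ≠ 0) {p : Σ _ : ℕ, ℕ} (hp : p ∈ pairs N) :
    p.1 * h N p.1 ^ 2 * cofactor N p.1 = N :=
  Nat.mul_div_cancel' (mem_pairs hN hp).2.2.2.1

lemma etaMK_transform {N : ℕ} (hN : N ≠ 0) {p : Σ _ : ℕ, ℕ} (hp : p ∈ pairs N)
    (hh : h N p.1 ∣ 24) {a b D : ℤ} {c d : ℕ} (hd : Odd d) (hd3 : ¬ 3 ∣ d)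
    (h1 : a * d - b * (N * c : ℕ) = 1) (hD : (d : ℤ) ^ 2 - 1 = 24 * D) {τ τ' : ℍ}
    (hτ : (τ' : ℂ) = (a * τ + b) / ((N * c : ℕ) * τ + d)) :
    etaMK N p.1 p.2 τ' = J((cofactor N p.1 * c : ℕ) | d) *
      zeta ^ (p.1 * b * d + p.2 * ((24 / h N p.1 : ℕ) * D) -
        d * (cofactor N p.1 * c : ℕ) * (Nat.gcd (h N p.1) p.2 : ℤ) ^ 2 + 3 * (d - 1) : ℤ) *
      (Complex.sqrt ((N * c : ℕ) * τ + d) * etaMK N p.1 p.2 τ) := by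
  obtain ⟨hm, hmN, hh0, hmh, hk⟩ := mem_pairs hN hp
  have hc : h N p.1 ^ 2 * p.1 * (cofactor N p.1 * c) = N * c := by
    conv_rhs => rw [← cofactor_mul hN hp]
    ring
  have hy : (h N p.1 : ℤ) * ((24 / h N p.1 : ℕ) * D) = (d : ℤ) ^ 2 - 1 := by
    rw [hD, ← mul_assoc, ← Nat.cast_mul, Nat.mul_div_cancel' hh]
    rfl
  have := eta_conj (a := a) (b := b) (p.2 : ℤ) hh0 hm (s := cofactor N p.1 * c) hd hd3
    (by rw [← h1, ← hc]; push_cast; ring) hy (z := τ) τ.im_pos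
  rw [hc] at this
  rw [etaMK, hτ]
  simpa [etaMK, Int.gcd_natCast_natCast] using this

/-- The transformation formula of an eta product under `Γ₀(N)`, in arbitrary weight. -/
lemma etaProduct_transform_aux {N : ℕ} (hN : N ≠ 0) (hh : ∀ m, m ∣ N → h N m ∣ 24) (e : ℕ → ℕ → ℤ)
    {a b D : ℤ} {c d : ℕ} (hd : Odd d) (hd3 : ¬ 3 ∣ d)
    (h1 : a * d - b * (N * c : ℕ) = 1) (hD : (d : ℤ) ^ 2 - 1 = 24 * D) {τ τ' : ℍ}
    (hτ : (τ' : ℂ) = (a * τ + b) / ((N * c : ℕ) * τ + d)) :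
    etaProduct N e τ' =
      (∏ p ∈ pairs N, (J((cofactor N p.1 * c : ℕ) | d) : ℂ) ^ e p.1 p.2) *
      (zeta ^ (∑ p ∈ pairs N, e p.1 p.2 *
        (p.1 * b * d + p.2 * ((24 / h N p.1 : ℕ) * D) -
        d * (cofactor N p.1 * c : ℕ) * (Nat.gcd (h N p.1) p.2 : ℤ) ^ 2 + 3 * (d - 1) : ℤ)) *
      (Complex.sqrt ((N * c : ℕ) * τ + d) ^ (∑ p ∈ pairs N, e p.1 p.2) * etaProduct N e τ)) := by
  have hsq : Complex.sqrt ((N * c : ℕ) * τ + d) ≠ 0 := by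
    rw [_root_.sqrt_eq_exp]
    · exact Complex.exp_ne_zero _
    · intro h0
      have e1 := congrArg Complex.im h0
      have e2 := congrArg Complex.re h0
      simp only [Complex.add_im, Complex.add_re, Complex.mul_im, Complex.mul_re, Complex.natCast_re,
        Complex.natCast_im, Complex.zero_im, Complex.zero_re, zero_mul, add_zero, sub_zero] at e1 e2
      rcases mul_eq_zero.1 e1 with h2 | h2
      · rw [h2] at e2
        have : (d : ℝ) = 0 := by linarith
        exact hd.pos.ne' (by exact_mod_cast this)
      · exact τ.im_pos.ne' h2
  rw [etaProduct, etaProduct, ← prod_zpow_eq_zpow_sum zeta_ne_zero,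
    ← prod_zpow_eq_zpow_sum hsq,
    ← Finset.prod_mul_distrib, ← Finset.prod_mul_distrib, ← Finset.prod_mul_distrib]
  refine Finset.prod_congr rfl fun p hp => ?_
  rw [etaMK_transform hN hp (hh _ (mem_pairs hN hp).2.1) hd hd3 h1 hD hτ, mul_zpow, mul_zpow,
    mul_zpow, ← zpow_mul, mul_comm (e p.1 p.2) (_ + _)]
  ring

/-- The character of a weight-zero eta product on `Γ₀(N)`. -/
theorem etaProduct_transform {N : ℕ} (hN : N ≠ 0) (hh : ∀ m, m ∣ N → h N m ∣ 24) {e : ℕ → ℕ → ℤ}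
    (he : ∑ p ∈ pairs N, e p.1 p.2 = 0)
    {a b D : ℤ} {c d : ℕ} (hd : Odd d) (hd3 : ¬ 3 ∣ d)
    (h1 : a * d - b * (N * c : ℕ) = 1) (hD : (d : ℤ) ^ 2 - 1 = 24 * D) {τ τ' : ℍ}
    (hτ : (τ' : ℂ) = (a * τ + b) / ((N * c : ℕ) * τ + d)) :
    etaProduct N e τ' = (∏ p ∈ pairs N, (J(p.1 | d) : ℂ) ^ e p.1 p.2) *
      zeta ^ (b * d * (∑ p ∈ pairs N, e p.1 p.2 * (p.1 : ℤ)) +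
        D * (∑ p ∈ pairs N, e p.1 p.2 * (p.2 * (24 / h N p.1 : ℕ))) -
        d * c * (∑ p ∈ pairs N, e p.1 p.2 *
          (cofactor N p.1 * (Nat.gcd (h N p.1) p.2 : ℤ) ^ 2))) * etaProduct N e τ := by
  have hcop : ((N * c : ℕ) : ℤ).gcd d = 1 := by
    rw [← Int.isCoprime_iff_gcd_eq_one]
    exact ⟨-b, a, by linear_combination h1⟩
  rw [etaProduct_transform_aux hN hh e hd hd3 h1 hD hτ, he, zpow_zero, one_mul, ← mul_assoc]
  congr 2
  -- Nc = m·h²·(cofactor·c) and symbols are ±1, so the symbol of cofactor·c is that of m times that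
  -- of Nc. The latter is the same for all pairs and disappears since the exponents sum to 0.
  · have hJ : ∀ p ∈ pairs N, (J((cofactor N p.1 * c : ℕ) | d) : ℂ) ^ e p.1 p.2 =
        (J(p.1 | d) : ℂ) ^ e p.1 p.2 * (J((N * c : ℕ) | d) : ℂ) ^ e p.1 p.2 := by
      intro p hp
      rw [← mul_zpow]
      congr 1
      have e1 : ((N * c : ℕ) : ℤ) = p.1 * ((h N p.1 : ℤ) ^ 2 * (cofactor N p.1 * c : ℕ)) := by
        conv_lhs => rw [← cofactor_mul hN hp]
        push_cast
        ring
      have c1 : (p.1 : ℤ).gcd d = 1 := by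
        rw [← Int.isCoprime_iff_gcd_eq_one] at hcop ⊢
        exact hcop.of_isCoprime_of_dvd_left ⟨_, e1⟩
      have c2 : (h N p.1 : ℤ).gcd d = 1 := by
        rw [← Int.isCoprime_iff_gcd_eq_one] at hcop ⊢
        exact hcop.of_isCoprime_of_dvd_left ⟨p.1 * (h N p.1 * (cofactor N p.1 * c : ℕ)), by rw [e1]; ring⟩
      have e2 := jacobiSym.sq_one c1
      rw [e1, jacobiSym.mul_left, jacobiSym.mul_left, jacobiSym.sq_one' c2]
      have e3 : (J(p.1 | d) : ℂ) ^ 2 = 1 := by exact_mod_cast e2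
      push_cast
      linear_combination (-(J((cofactor N p.1 * c : ℤ) | d) : ℂ)) * e3
    rw [Finset.prod_congr rfl hJ, Finset.prod_mul_distrib, prod_zpow_eq_zpow_sum, he,
      zpow_zero, mul_one]
    exact_mod_cast jacobiSym.ne_zero hcop
  · congr 1
    have : ∑ p ∈ pairs N, e p.1 p.2 * (3 * ((d : ℤ) - 1)) = 0 := by
      rw [← Finset.sum_mul, he, zero_mul]
    refine Eq.trans ?_ (add_zero _)
    rw [← this, Finset.mul_sum, Finset.mul_sum, Finset.mul_sum, ← Finset.sum_add_distrib,
      ← Finset.sum_sub_distrib, ← Finset.sum_add_distrib]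
    refine Finset.sum_congr rfl fun p _ => ?_
    push_cast
    ring

lemma exists_sq_sub_one {d : ℕ} (hd : Odd d) (hd3 : ¬ 3 ∣ d) : ∃ D : ℤ, (d : ℤ) ^ 2 - 1 = 24 * D := by
  have h8 := Int.eight_dvd_sq_sub_one_of_odd (k := (d : ℤ)) (by exact_mod_cast hd)
  have h3 : (3 : ℤ) ∣ (d : ℤ) ^ 2 - 1 := by
    have : (d : ℤ) % 3 = 1 ∨ (d : ℤ) % 3 = 2 := by omega
    apply Int.dvd_of_emod_eq_zero
    rcases this with h | h <;> simp [pow_two, Int.mul_emod, Int.sub_emod, h]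
  have : (24 : ℤ) ∣ (d : ℤ) ^ 2 - 1 := by omega
  exact this

/-! ### Invariance as a condition on characters -/

/-- The matrix of `SL(2, ℤ)` with given entries. -/
def slMk (a b c d : ℤ) (h : a * d - b * c = 1) : SL(2, ℤ) :=
  ⟨!![a, b; c, d], by rw [Matrix.det_fin_two_of, h]⟩

lemma coe_slMk_smul (a b c d : ℤ) (h : a * d - b * c = 1) (τ : ℍ) :
    ((slMk a b c d h • τ : ℍ) : ℂ) = (a * τ + b) / (c * τ + d) := by
  rw [UpperHalfPlane.coe_specialLinearGroup_apply]
  simp [slMk]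

lemma coe_smul_eq (γ : SL(2, ℤ)) (τ : ℍ) :
    ((γ • τ : ℍ) : ℂ) = ((γ 0 0 : ℤ) * τ + (γ 0 1 : ℤ)) / ((γ 1 0 : ℤ) * τ + (γ 1 1 : ℤ)) := by
  rw [UpperHalfPlane.coe_specialLinearGroup_apply]
  simp

lemma slMk_mem_Gamma0 {N : ℕ} {a b c d : ℤ} (h : a * d - b * c = 1) (hc : (N : ℤ) ∣ c) :
    slMk a b c d h ∈ CongruenceSubgroup.Gamma0 N := by
  rw [CongruenceSubgroup.Gamma0_mem]
  exact (ZMod.intCast_zmod_eq_zero_iff_dvd c N).2 hc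

lemma det_eq (γ : SL(2, ℤ)) : γ 0 0 * γ 1 1 - γ 0 1 * γ 1 0 = 1 := by
  rw [← Matrix.det_fin_two]
  exact γ.2

/-- The nonarchimedean part of the character of an eta product, at a given lower right entry. -/
def etaCharacter (N : ℕ) (e : ℕ → ℕ → ℤ) (d : ℕ) (D : ℤ) : ℂ :=
  (∏ p ∈ pairs N, (J(p.1 | d) : ℂ) ^ e p.1 p.2) *
    zeta ^ (D * (∑ p ∈ pairs N, e p.1 p.2 * (p.2 * (24 / h N p.1 : ℕ))))

/-- Absolute values of the transformation law of (1 0; N 1) at τ = i leave only |√(Ni + 1)| to the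
power ∑ e, and |Ni + 1| > 1. -/
lemma sum_eq_zero_of_invariant {N : ℕ} (hN : N ≠ 0) (hh : ∀ m, m ∣ N → h N m ∣ 24)
    {e : ℕ → ℕ → ℤ}
    (hinv : ∀ γ ∈ CongruenceSubgroup.Gamma0 N, ∀ τ : ℍ, etaProduct N e (γ • τ) = etaProduct N e τ) :
    ∑ p ∈ pairs N, e p.1 p.2 = 0 := by
  have hdet : (1 : ℤ) * 1 - 0 * N = 1 := by ring
  have h1 := hinv _ (slMk_mem_Gamma0 hdet dvd_rfl) UpperHalfPlane.I
  have h2 := etaProduct_transform_aux hN hh e (a := 1) (b := 0) (c := 1) (d := 1) (D := 0)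
    odd_one (by norm_num) (by simp) (by simp) (τ := UpperHalfPlane.I)
    (τ' := slMk 1 0 N 1 hdet • UpperHalfPlane.I) (by rw [coe_slMk_smul]; simp)
  rw [h1] at h2
  have h3 := congrArg norm h2
  simp only [jacobiSym.one_right, Int.cast_one, one_zpow, Finset.prod_const_one, one_mul, norm_mul,
    norm_zpow, norm_zeta] at h3
  have h4 := norm_ne_zero_iff.2 (etaProduct_ne_zero hN e UpperHalfPlane.I)
  have h5 := (mul_eq_right₀ h4).1 h3.symm
  set w : ℂ := ((N * 1 : ℕ) : ℂ) * (UpperHalfPlane.I : ℍ) + (1 : ℕ) with hw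
  have hw1 : 1 < ‖w‖ := by
    have : ‖w‖ ^ 2 = 1 + (N : ℝ) ^ 2 := by
      rw [← Complex.normSq_eq_norm_sq, Complex.normSq_apply, hw]
      simp
      ring
    have hN' : (0 : ℝ) < N := by exact_mod_cast Nat.pos_of_ne_zero hN
    by_contra! hle
    nlinarith [norm_nonneg w]
  have hs : 1 < ‖Complex.sqrt w‖ := by
    have e1 : Complex.sqrt w ^ 2 = w := by
      simp [Complex.sqrt]
    have e2 := congrArg norm e1
    rw [norm_pow] at e2
    by_contra! hle
    nlinarith [norm_nonneg (Complex.sqrt w)]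
  rcases lt_trichotomy (∑ p ∈ pairs N, e p.1 p.2) 0 with hlt | h0 | hgt
  · exact absurd h5 (zpow_lt_one_of_neg₀ hs hlt).ne
  · exact h0
  · exact absurd h5 (one_lt_zpow₀ hs hgt).ne'

lemma exists_shift_coprime_six {a b c d : ℤ} (hdet : a * d - b * c = 1) (hc : 0 < c) :
    ∃ j : ℤ, 0 < d + j * c ∧ (d + j * c) % 2 = 1 ∧ (d + j * c) % 3 ≠ 0 := by
  have h2 : ¬ (c % 2 = 0 ∧ d % 2 = 0) := by
    rintro ⟨h1, h2⟩
    obtain ⟨x, rfl⟩ := Int.dvd_of_emod_eq_zero h1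
    obtain ⟨y, rfl⟩ := Int.dvd_of_emod_eq_zero h2
    have : 2 * (a * y - b * x) = 1 := by linear_combination hdet
    omega
  have h3 : ¬ (c % 3 = 0 ∧ d % 3 = 0) := by
    rintro ⟨h1, h3⟩
    obtain ⟨x, rfl⟩ := Int.dvd_of_emod_eq_zero h1
    obtain ⟨y, rfl⟩ := Int.dvd_of_emod_eq_zero h3
    have : 3 * (a * y - b * x) = 1 := by linear_combination hdet
    omega
  -- c and d are not both divisible by 2, nor both by 3, so one of i = 0, 1, 3, 4 makes d + ic prime
  -- to 6.
  obtain ⟨i, hi0, hi2, hi3⟩ : ∃ i : ℤ, 0 ≤ i ∧ (d + i * c) % 2 = 1 ∧ (d + i * c) % 3 ≠ 0 := by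
    by_cases e2 : d % 2 = 1 <;> by_cases e3 : d % 3 = 0
    · exact ⟨4, by norm_num, by omega, by omega⟩
    · exact ⟨0, by norm_num, by omega, by omega⟩
    · exact ⟨1, by norm_num, by omega, by omega⟩
    · exact ⟨3, by norm_num, by omega, by omega⟩
  -- Adding 6|d| to i preserves residues modulo 6 and makes the entry positive.
  have e : d + (i + 6 * |d|) * c = d + i * c + 6 * (|d| * c) := by ring
  refine ⟨i + 6 * |d|, ?_, by rw [e]; omega, by rw [e]; omega⟩
  have h4 : 0 ≤ i * c := mul_nonneg hi0 hc.le
  have h5 : |d| ≤ |d| * c := le_mul_of_one_le_right (abs_nonneg d) hc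
  have h6 := neg_abs_le d
  have h7 := abs_nonneg d
  rw [e]
  by_contra! hle
  have hd0 : |d| = 0 := by linarith
  have : d = 0 := abs_eq_zero.1 hd0
  subst this
  have : i * c = 0 := by simp at hle; linarith
  rw [this] at hi2
  omega

/-- For the converse, γ is changed by a sign and by a power of τ ↦ τ + 1 on the right until its
lower right entry is positive and prime to 6, where `etaProduct_transform` applies. -/
theorem invariant_iff {N : ℕ} (hN : N ≠ 0) (hh : ∀ m, m ∣ N → h N m ∣ 24) (e : ℕ → ℕ → ℤ) :
    (∀ γ ∈ CongruenceSubgroup.Gamma0 N, ∀ τ : ℍ, etaProduct N e (γ • τ) = etaProduct N e τ) ↔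
      (∑ p ∈ pairs N, e p.1 p.2 = 0) ∧
      (24 : ℤ) ∣ ∑ p ∈ pairs N, e p.1 p.2 * (p.1 : ℤ) ∧
      (24 : ℤ) ∣ ∑ p ∈ pairs N, e p.1 p.2 *
        (cofactor N p.1 * (Nat.gcd (h N p.1) p.2 : ℤ) ^ 2) ∧
      ∀ (d : ℕ) (D : ℤ), Odd d → ¬ 3 ∣ d → d.Coprime N → (d : ℤ) ^ 2 - 1 = 24 * D →
        etaCharacter N e d D = 1 := by
  constructor
  · intro hinv
    have he := sum_eq_zero_of_invariant hN hh hinv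
    have hB : (24 : ℤ) ∣ ∑ p ∈ pairs N, e p.1 p.2 * (p.1 : ℤ) := by
      have hdet : (1 : ℤ) * 1 - 1 * 0 = 1 := by ring
      have h1 := hinv _ (slMk_mem_Gamma0 hdet (dvd_zero _)) UpperHalfPlane.I
      rw [etaProduct_vadd_int N e (τ := UpperHalfPlane.I) 1 (by rw [coe_slMk_smul]; simp),
        one_mul] at h1
      exact (zeta_zpow_eq_one_iff _).1
        ((mul_eq_right₀ (etaProduct_ne_zero hN e _)).1 h1)
    have hC : (24 : ℤ) ∣ ∑ p ∈ pairs N, e p.1 p.2 *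
        (cofactor N p.1 * (Nat.gcd (h N p.1) p.2 : ℤ) ^ 2) := by
      have hdet : (1 : ℤ) * 1 - 0 * N = 1 := by ring
      have h1 := hinv _ (slMk_mem_Gamma0 hdet dvd_rfl) UpperHalfPlane.I
      rw [etaProduct_transform hN hh he (a := 1) (b := 0) (c := 1) (d := 1) (D := 0)
        odd_one (by norm_num) (by simp) (by simp) (τ := UpperHalfPlane.I)
        (by rw [coe_slMk_smul]; simp)] at h1
      have h2 := (mul_eq_right₀ (etaProduct_ne_zero hN e _)).1 h1
      simp only [jacobiSym.one_right, Int.cast_one, one_zpow, Finset.prod_const_one, one_mul] at h2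
      have h3 := (zeta_zpow_eq_one_iff _).1 h2
      simpa using h3
    refine ⟨he, hB, hC, fun d D hd hd3 hcop hD => ?_⟩
    -- Bézout completes (N, d) to the bottom row of a matrix in Γ₀(N).
    obtain ⟨u, v, huv⟩ := Nat.isCoprime_iff_coprime.2 hcop
    have hdet : u * (d : ℤ) - (-v) * N = 1 := by linear_combination huv
    have h1 := hinv _ (slMk_mem_Gamma0 hdet dvd_rfl) UpperHalfPlane.I
    rw [etaProduct_transform hN hh he (a := u) (b := -v) (c := 1) (d := d) (D := D)
        hd hd3 (by rw [← hdet]; simp) hD (τ := UpperHalfPlane.I)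
        (by rw [coe_slMk_smul]; simp)] at h1
    have h2 := (mul_eq_right₀ (etaProduct_ne_zero hN e _)).1 h1
    rw [← h2, etaCharacter]
    congr 1
    apply zeta_zpow_congr
    obtain ⟨x, hx⟩ := hB
    obtain ⟨y, hy⟩ := hC
    exact ⟨d * y + v * d * x, by rw [hx, hy]; push_cast; ring⟩
  · rintro ⟨he, hB, hC, hchar⟩
    have hT : ∀ (j : ℤ) (τ : ℍ), etaProduct N e (ModularGroup.T ^ j • τ) = etaProduct N e τ := by
      intro j τ
      rw [etaProduct_vadd_int N e (τ := τ) j (ModularGroup.coe_T_zpow_smul_eq τ),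
        (zeta_zpow_eq_one_iff _).2 (hB.mul_left _), one_mul]
    have good : ∀ (γ : SL(2, ℤ)) (c d : ℕ), γ 1 0 = (N * c : ℕ) → γ 1 1 = d → Odd d → ¬ 3 ∣ d →
        ∀ τ : ℍ, etaProduct N e (γ • τ) = etaProduct N e τ := by
      intro γ c d hc hd hodd hd3 τ
      obtain ⟨D, hD⟩ := exists_sq_sub_one hodd hd3
      have hdet := det_eq γ
      rw [hc, hd] at hdet
      rw [etaProduct_transform hN hh he (a := γ 0 0) (b := γ 0 1) (c := c) (d := d) (D := D)
        hodd hd3 hdet hD (τ := τ) (by rw [coe_smul_eq, hc, hd]; push_cast; rfl)]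
      have hcop : d.Coprime N := by
        rw [← Nat.isCoprime_iff_coprime]
        exact ⟨γ 0 0, -(γ 0 1 * c), by push_cast at hdet; linear_combination hdet⟩
      have h1 := hchar d D hodd hd3 hcop hD
      rw [etaCharacter] at h1
      conv_rhs => rw [← one_mul (etaProduct N e τ), ← h1]
      congr 2
      apply zeta_zpow_congr
      obtain ⟨x, hx⟩ := hB
      obtain ⟨y, hy⟩ := hC
      exact ⟨γ 0 1 * d * x - d * c * y, by rw [hx, hy]; ring⟩
    have pos : ∀ γ ∈ CongruenceSubgroup.Gamma0 N, 0 < γ 1 0 →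
        ∀ τ : ℍ, etaProduct N e (γ • τ) = etaProduct N e τ := by
      intro γ hγ hc τ
      obtain ⟨j, hj, hj2, hj3⟩ := exists_shift_coprime_six (det_eq γ) hc
      have h10 : (γ * ModularGroup.T ^ j) 1 0 = γ 1 0 := by
        simp [Matrix.SpecialLinearGroup.coe_mul, ModularGroup.coe_T_zpow, Matrix.mul_apply,
          Fin.sum_univ_two]
      have h11 : (γ * ModularGroup.T ^ j) 1 1 = γ 1 1 + j * γ 1 0 := by
        simp [Matrix.SpecialLinearGroup.coe_mul, ModularGroup.coe_T_zpow, Matrix.mul_apply,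
          Fin.sum_univ_two]
        ring
      have hdvd : (N : ℤ) ∣ γ 1 0 :=
        (ZMod.intCast_zmod_eq_zero_iff_dvd _ N).1 (CongruenceSubgroup.Gamma0_mem.1 hγ)
      obtain ⟨c, hcN⟩ := hdvd
      have hc0 : 0 ≤ c := by
        by_contra! h0
        have : (0 : ℤ) < N := by exact_mod_cast Nat.pos_of_ne_zero hN
        nlinarith
      have key := good (γ * ModularGroup.T ^ j) c.toNat (γ 1 1 + j * γ 1 0).toNat
        (by rw [h10, hcN]; push_cast; rw [Int.toNat_of_nonneg hc0])
        (by rw [h11, Int.toNat_of_nonneg hj.le]) (Nat.odd_iff.2 (by omega)) (by omega)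
        (ModularGroup.T ^ (-j) • τ)
      rw [mul_smul, ← mul_smul (ModularGroup.T ^ j), ← zpow_add, add_neg_cancel, zpow_zero,
        one_smul, hT] at key
      exact key
    intro γ hγ τ
    rcases lt_trichotomy (γ 1 0) 0 with hc | hc | hc
    · rw [← ModularGroup.SL_neg_smul γ τ]
      refine pos (-γ) ?_ (by simpa using hc) τ
      rw [CongruenceSubgroup.Gamma0_mem] at hγ ⊢
      simpa using hγ
    · have hdet := det_eq γ
      rw [hc, mul_zero, sub_zero] at hdet
      rcases Int.isUnit_iff.1 (IsUnit.of_mul_eq_one_right _ hdet) with hd | hd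
      · exact good γ 0 1 (by simpa using hc) (by simpa using hd) odd_one (by norm_num) τ
      · rw [← ModularGroup.SL_neg_smul γ τ]
        exact good (-γ) 0 1 (by simpa using hc) (by simp [hd]) odd_one (by norm_num) τ
    · exact pos γ hγ hc τ

/-! ### Growth and meromorphy at the cusps -/

/-- The `SL(2, ℤ)`-invariant quantity `|η(τ)|⁴ Im τ`. -/
def etaHeight (τ : ℍ) : ℝ := ‖eta τ‖ ^ 4 * τ.im

lemma norm_sqrt_pow_four (z : ℂ) : ‖Complex.sqrt z‖ ^ 4 = Complex.normSq z := by
  have e1 : Complex.sqrt z ^ 2 = z := by simp [Complex.sqrt]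
  rw [Complex.normSq_eq_norm_sq, ← e1, norm_pow]
  simp only [e1]
  ring

lemma etaHeight_T (τ : ℍ) : etaHeight (ModularGroup.T • τ) = etaHeight τ := by
  have h1 : ((ModularGroup.T • τ : ℍ) : ℂ) = τ + 1 := by
    simpa using ModularGroup.coe_T_zpow_smul_eq τ (n := 1)
  have h2 : (ModularGroup.T • τ : ℍ).im = τ.im := by
    rw [← UpperHalfPlane.coe_im, h1]
    simp
  rw [etaHeight, etaHeight, h1, h2, eta_add_one, norm_mul, norm_zeta, one_mul]

lemma etaHeight_S (τ : ℍ) : etaHeight (ModularGroup.S • τ) = etaHeight τ := by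
  have h1 : ((ModularGroup.S • τ : ℍ) : ℂ) = -1 / τ := by
    rw [UpperHalfPlane.modular_S_smul]
    simp [neg_div, inv_neg]
  have h2 : (ModularGroup.S • τ : ℍ).im = τ.im / Complex.normSq τ := by
    rw [← UpperHalfPlane.coe_im, h1, neg_div, one_div, Complex.neg_im, Complex.inv_im]
    simp [neg_div]
  have h3 : Complex.normSq (τ : ℂ) ≠ 0 := τ.normSq_pos.ne'
  rw [etaHeight, etaHeight, h1, h2, eta_neg_inv τ.im_pos, norm_mul, norm_mul, norm_zpow, norm_zeta,
    one_zpow, one_mul, mul_pow, norm_sqrt_pow_four]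
  field_simp

lemma etaHeight_smul (γ : SL(2, ℤ)) (τ : ℍ) : etaHeight (γ • τ) = etaHeight τ := by
  have hγ : γ ∈ Subgroup.closure {ModularGroup.S, ModularGroup.T} := by
    simp [SpecialLinearGroup.SL2Z_generators]
  induction hγ using Subgroup.closure_induction generalizing τ with
  | mem x hx =>
    rcases hx with rfl | rfl
    · exact etaHeight_S τ
    · exact etaHeight_T τ
  | one => simp
  | mul x y _ _ hx hy => rw [mul_smul, hx, hy]
  | inv x _ hx => rw [← hx (x⁻¹ • τ), smul_inv_smul]

lemma denom_ne_zero (γ : SL(2, ℤ)) {z : ℂ} (hz : 0 < z.im) : ((γ 1 0 : ℤ) : ℂ) * z + (γ 1 1 : ℤ) ≠ 0 := by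
  intro h0
  have e1 := congrArg Complex.im h0
  have e2 := congrArg Complex.re h0
  simp only [Complex.add_im, Complex.add_re, Complex.mul_im, Complex.mul_re, Complex.intCast_re,
    Complex.intCast_im, Complex.zero_im, Complex.zero_re, zero_mul, add_zero, sub_zero] at e1 e2
  have hdet := det_eq γ
  rcases mul_eq_zero.1 e1 with h2 | h2
  · rw [h2] at e2
    have h3 : γ 1 0 = 0 := by exact_mod_cast h2
    have h4 : γ 1 1 = 0 := by
      have : ((γ 1 1 : ℤ) : ℝ) = 0 := by linarith
      exact_mod_cast this
    rw [h3, h4] at hdet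
    simp at hdet
  · exact hz.ne' h2

/-- Up to `SL(2, ℤ)`, the composite of `γ` and `τ ↦ m τ + k / h` is an affine map. -/
lemma exists_etaHeight_affine (γ : SL(2, ℤ)) {m h : ℕ} (hm : 0 < m) (hh : 0 < h) (k : ℕ) :
    ∃ r s : ℝ, 0 < r ∧ ∀ τ z w : ℍ, (z : ℂ) = m * (γ • τ : ℍ) + k / h →
      (w : ℂ) = r * τ + s → etaHeight z = etaHeight w := by
  -- X, Y, Z, W are the entries of (hm k; 0 h)·γ. With g = gcd(X, Z), this is an SL(2, ℤ) matrix
  -- with first column (X/g, Z/g) times an upper triangular one with diagonal g, h²m/g.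
  set X : ℤ := h * m * γ 0 0 + k * γ 1 0 with hX
  set Y : ℤ := h * m * γ 0 1 + k * γ 1 1 with hY
  set Z : ℤ := h * γ 1 0 with hZ
  set W : ℤ := h * γ 1 1 with hW
  have hdet : X * W - Y * Z = h ^ 2 * m := by
    rw [hX, hY, hZ, hW]
    linear_combination (h ^ 2 * m : ℤ) * det_eq γ
  have hpos : (0 : ℤ) < h ^ 2 * m := by positivity
  have hg : 0 < Int.gcd X Z := by
    rw [Int.gcd_pos_iff]
    by_contra! hcon
    rw [hcon.1, hcon.2] at hdet
    simp at hdet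
    omega
  obtain ⟨x, hx⟩ := Int.gcd_dvd_left X Z
  obtain ⟨y, hy⟩ := Int.gcd_dvd_right X Z
  have hbez := Int.gcd_eq_gcd_ab X Z
  set g : ℤ := ((Int.gcd X Z : ℕ) : ℤ) with hgdef
  set u := Int.gcdA X Z
  set v := Int.gcdB X Z
  have hg0 : (0 : ℤ) < g := by rw [hgdef]; exact_mod_cast hg
  have huv : x * u - (-v) * y = 1 := by
    apply mul_left_cancel₀ hg0.ne'
    linear_combination -hbez - u * hx - v * hy
  have ht : g * (x * W - y * Y) = h ^ 2 * m := by
    linear_combination hdet - W * hx + Y * hy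
  have ht0 : 0 < x * W - y * Y := pos_of_mul_pos_right (ht ▸ hpos) hg0.le
  have hgC : (g : ℂ) ≠ 0 := by exact_mod_cast hg0.ne'
  have htC : ((x * W - y * Y : ℤ) : ℂ) ≠ 0 := by exact_mod_cast ht0.ne'
  refine ⟨(g : ℝ) / ((x * W - y * Y : ℤ) : ℝ), ((u * Y + v * W : ℤ) : ℝ) / ((x * W - y * Y : ℤ) : ℝ),
    div_pos (by exact_mod_cast hg0) (by exact_mod_cast ht0), fun τ z w hz hw => ?_⟩
  have hzw : z = slMk x (-v) y u huv • w := by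
    ext
    have hxC : (X : ℂ) = g * x := by exact_mod_cast hx
    have hyC : (Z : ℂ) = g * y := by exact_mod_cast hy
    have hhC : (h : ℂ) ≠ 0 := by exact_mod_cast hh.ne'
    have hden := denom_ne_zero γ τ.im_pos
    have huvC : (x : ℂ) * u + v * y = 1 := by
      have := congrArg (Int.cast : ℤ → ℂ) huv
      push_cast at this
      linear_combination this
    have hw' : (w : ℂ) = (g * τ + (u * Y + v * W)) / ((x * W - y * Y : ℤ) : ℂ) := by
      rw [hw]
      push_cast
      field_simp
    have n1 : x * (w : ℂ) + (-v : ℤ) = (X * τ + Y) / ((x * W - y * Y : ℤ) : ℂ) := by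
      rw [hw', eq_div_iff htC, add_mul, mul_div_assoc', div_mul_cancel₀ _ htC, hxC]
      push_cast
      linear_combination (Y : ℂ) * huvC
    have n2 : y * (w : ℂ) + u = (Z * τ + W) / ((x * W - y * Y : ℤ) : ℂ) := by
      rw [hw', eq_div_iff htC, add_mul, mul_div_assoc', div_mul_cancel₀ _ htC, hyC]
      push_cast
      linear_combination (W : ℂ) * huvC
    have hZW : (Z : ℂ) * τ + W = h * ((γ 1 0 : ℤ) * τ + (γ 1 1 : ℤ)) := by
      rw [hZ, hW]
      push_cast
      ring
    rw [coe_slMk_smul, n1, n2, div_div_div_cancel_right₀ htC, hz, coe_smul_eq, hZW,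
      eq_div_iff (mul_ne_zero hhC hden), hX, hY]
    have aux : ∀ P Q : ℂ, Q ≠ 0 → (m * (P / Q) + k / h : ℂ) * (h * Q) = h * m * P + k * Q := by
      intro P Q hQ
      field_simp
    rw [aux _ _ hden]
    push_cast
    ring
  rw [hzw, etaHeight_smul]

/-- η is q^(1/24) times a product tending to 1 as q → 0. The bounds are mutually inverse so that
positive and negative exponents are treated alike. -/
lemma exists_eta_bounds : ∃ A : ℝ, 0 ≤ A ∧ ∀ z : ℂ, A ≤ z.im →
    (2 * Real.exp (π * z.im / 12))⁻¹ ≤ ‖eta z‖ ∧ ‖eta z‖ ≤ 2 * Real.exp (π * z.im / 12) := by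
  set φ : ℂ → ℂ := fun q => ∏' n : ℕ, (1 - q ^ (n + 1)) with hφ
  have hcont : ContinuousAt φ 0 :=
    (differentiableOn_tprod_one_sub_pow.differentiableAt
      (Metric.ball_mem_nhds (0 : ℂ) one_pos)).continuousAt
  have hφ0 : φ 0 = 1 := by simp [hφ]
  have hn : Filter.Tendsto (fun q => ‖φ q‖) (nhds 0) (nhds 1) := by
    simpa [hφ0] using hcont.norm.tendsto
  have h1 := hn.eventually (Icc_mem_nhds (show (1 / 2 : ℝ) < 1 by norm_num) (show (1 : ℝ) < 2 by norm_num))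
  obtain ⟨δ, hδ, hball⟩ := Metric.eventually_nhds_iff.1 h1
  have hlim : Filter.Tendsto (fun y : ℝ => Real.exp (-2 * π * y)) Filter.atTop (nhds 0) := by
    apply Real.tendsto_exp_atBot.comp
    exact Filter.tendsto_id.const_mul_atTop_of_neg (by linarith [Real.pi_pos])
  obtain ⟨A, hA⟩ := Filter.eventually_atTop.1 (hlim.eventually (gt_mem_nhds hδ))
  refine ⟨max A 0, le_max_right _ _, fun z hz => ?_⟩
  have hz0 : 0 ≤ z.im := (le_max_right _ _).trans hz
  have hq : ‖Function.Periodic.qParam 1 z‖ < δ := by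
    rw [Function.Periodic.norm_qParam, div_one]
    exact hA _ ((le_max_left _ _).trans hz)
  have h2 := hball (by simpa using hq)
  have h3 : eta z = Function.Periodic.qParam 24 z * φ (Function.Periodic.qParam 1 z) := rfl
  have h4 : ‖Function.Periodic.qParam 24 z‖ = (Real.exp (π * z.im / 12))⁻¹ := by
    rw [Function.Periodic.norm_qParam, ← Real.exp_neg]
    congr 1
    ring
  have h5 : 1 ≤ Real.exp (π * z.im / 12) := Real.one_le_exp (by positivity)
  have h6 : (Real.exp (π * z.im / 12))⁻¹ ≤ 1 := inv_le_one_of_one_le₀ h5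
  have h7 : 0 < (Real.exp (π * z.im / 12))⁻¹ := by positivity
  rw [h3, norm_mul, h4]
  refine ⟨?_, ?_⟩
  · rw [mul_inv, mul_comm]
    exact mul_le_mul_of_nonneg_left (by linarith [h2.1]) h7.le
  · calc _ ≤ 1 * 2 := mul_le_mul h6 h2.2 (norm_nonneg _) zero_le_one
      _ ≤ _ := by linarith

lemma zpow_le_pow_natAbs {x B : ℝ} (hB : 1 ≤ B) (h1 : B⁻¹ ≤ x) (h2 : x ≤ B) (e : ℤ) :
    x ^ e ≤ B ^ e.natAbs := by
  have hB0 : 0 < B := by linarith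
  have hx : 0 < x := (inv_pos.2 hB0).trans_le h1
  rcases Int.natAbs_eq e with he | he
  · rw [he, zpow_natCast, Int.natAbs_natCast]
    exact pow_le_pow_left₀ hx.le h2 _
  · rw [he, zpow_neg, zpow_natCast, Int.natAbs_neg, Int.natAbs_natCast, ← inv_pow]
    exact pow_le_pow_left₀ (inv_pos.2 hx).le (inv_le_of_inv_le₀ hB0 h1) _

/-- At most exponential growth in `Im τ` for large `Im τ`. -/
def ExpGrowth (u : ℍ → ℝ) : Prop :=
  ∃ A C K : ℝ, 0 ≤ C ∧ ∀ τ : ℍ, A ≤ τ.im → u τ ≤ C * Real.exp (K * τ.im)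

lemma ExpGrowth.prod {ι : Type*} (s : Finset ι) {u : ι → ℍ → ℝ} (h0 : ∀ i ∈ s, ∀ τ, 0 ≤ u i τ)
    (hu : ∀ i ∈ s, ExpGrowth (u i)) : ExpGrowth fun τ => ∏ i ∈ s, u i τ := by
  classical
  induction s using Finset.induction_on with
  | empty => exact ⟨0, 1, 0, zero_le_one, by simp⟩
  | insert i s hi ih =>
    obtain ⟨A, C, K, hC, h⟩ := ih (fun j hj => h0 j (Finset.mem_insert_of_mem hj))
      (fun j hj => hu j (Finset.mem_insert_of_mem hj))
    obtain ⟨A', C', K', hC', h'⟩ := hu i (Finset.mem_insert_self i s)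
    refine ⟨max A A', C' * C, K' + K, mul_nonneg hC' hC, fun τ hτ => ?_⟩
    beta_reduce
    rw [Finset.prod_insert hi, add_mul, Real.exp_add, mul_mul_mul_comm]
    exact mul_le_mul (h' τ ((le_max_right _ _).trans hτ)) (h τ ((le_max_left _ _).trans hτ))
      (Finset.prod_nonneg fun j hj => h0 j (Finset.mem_insert_of_mem hj) τ) (by positivity)

/-- The point `r τ + s` of the upper half-plane. -/
def affinePoint {r : ℝ} (hr : 0 < r) (s : ℝ) (τ : ℍ) : ℍ :=
  ⟨r * τ + s, by simpa using mul_pos hr τ.im_pos⟩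

lemma expGrowth_eta_affine {r : ℝ} (hr : 0 < r) (s x : ℝ) (hx : 0 < x) (e : ℤ) :
    ExpGrowth fun τ => (x * ‖eta (affinePoint hr s τ)‖ ^ 4) ^ e := by
  obtain ⟨A, hA0, hA⟩ := exists_eta_bounds
  refine ⟨A / r, x ^ e * (2 ^ e.natAbs) ^ 4, 4 * (e.natAbs * (π * r / 12)), by positivity,
    fun τ hτ => ?_⟩
  have him : ((affinePoint hr s τ : ℍ) : ℂ).im = r * τ.im := by simp [affinePoint]
  have hle : A ≤ r * τ.im := by
    rw [div_le_iff₀ hr] at hτ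
    linarith
  obtain ⟨h1, h2⟩ := hA (affinePoint hr s τ) (him ▸ hle)
  rw [him] at h1 h2
  have hB : 1 ≤ 2 * Real.exp (π * (r * τ.im) / 12) := by
    have := Real.one_le_exp (x := π * (r * τ.im) / 12)
      (by have := mul_pos hr τ.im_pos; positivity)
    linarith
  have h3 := zpow_le_pow_natAbs hB h1 h2 e
  have hpos : 0 ≤ ‖eta (affinePoint hr s τ)‖ ^ e := by positivity
  have e1 : (‖eta (affinePoint hr s τ)‖ ^ 4) ^ e = (‖eta (affinePoint hr s τ)‖ ^ e) ^ 4 := by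
    rw [← zpow_natCast, ← zpow_natCast, zpow_comm]
  have e2 : ((2 * Real.exp (π * (r * τ.im) / 12)) ^ e.natAbs) ^ 4 =
      (2 ^ e.natAbs) ^ 4 * Real.exp (4 * (e.natAbs * (π * r / 12)) * τ.im) := by
    rw [mul_pow, mul_pow, ← Real.exp_nat_mul, ← Real.exp_nat_mul]
    congr 2
    push_cast
    ring
  beta_reduce
  rw [mul_zpow, e1, mul_assoc, ← e2]
  exact mul_le_mul_of_nonneg_left (pow_le_pow_left₀ hpos h3 4) (by positivity)

lemma expGrowth_etaProduct_smul {N : ℕ} (hN : N ≠ 0) {e : ℕ → ℕ → ℤ}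
    (he : ∑ p ∈ pairs N, e p.1 p.2 = 0) (γ : SL(2, ℤ)) :
    ExpGrowth fun τ => ‖etaProduct N e (γ • τ)‖ ^ 4 := by
  have hex : ∀ p : Σ _ : ℕ, ℕ, ∃ r s : ℝ, 0 < r ∧ (p ∈ pairs N → ∀ τ z w : ℍ,
      (z : ℂ) = p.1 * (γ • τ : ℍ) + p.2 / h N p.1 → (w : ℂ) = r * τ + s →
      etaHeight z = etaHeight w) := by
    intro p
    by_cases hp : p ∈ pairs N
    · obtain ⟨hm, -, hh, -⟩ := mem_pairs hN hp
      obtain ⟨r, s, hr, H⟩ := exists_etaHeight_affine γ hm hh p.2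
      exact ⟨r, s, hr, fun _ => H⟩
    -- Dummy values off `pairs N`, so that `choose` gives total functions.
    · exact ⟨1, 0, one_pos, fun hp' => absurd hp' hp⟩
  choose r s hr H using hex
  have key : ∀ τ : ℍ, ‖etaProduct N e (γ • τ)‖ ^ 4 =
      ∏ p ∈ pairs N, ((r p / p.1) * ‖eta (affinePoint (hr p) (s p) τ)‖ ^ 4) ^ e p.1 p.2 := by
    intro τ
    have hρ : τ.im / (γ • τ : ℍ).im ≠ 0 := div_ne_zero τ.im_ne_zero (γ • τ : ℍ).im_ne_zero
    -- The factor Im τ / Im γτ does not depend on the pair, so it cancels in weight zero.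
    have h1 : ∀ p ∈ pairs N, ‖etaMK N p.1 p.2 (γ • τ)‖ ^ 4 =
        ((r p / p.1) * ‖eta (affinePoint (hr p) (s p) τ)‖ ^ 4) * (τ.im / (γ • τ : ℍ).im) := by
      intro p hp
      have hm := (mem_pairs hN hp).1
      have hm' : (p.1 : ℝ) ≠ 0 := by exact_mod_cast hm.ne'
      have h2 := H p hp τ ⟨_, im_etaMK_arg_pos hm p.2 (h N p.1) (γ • τ)⟩
        (affinePoint (hr p) (s p) τ) rfl rfl
      have h3 : (((p.1 : ℂ) * (γ • τ : ℍ) + (p.2 : ℂ) / (h N p.1 : ℂ))).im = p.1 * (γ • τ : ℍ).im := by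
        have : ((p.2 : ℂ) / h N p.1).im = 0 := by
          rw [show (p.2 : ℂ) / h N p.1 = ((p.2 / h N p.1 : ℝ) : ℂ) by push_cast; rfl,
            Complex.ofReal_im]
        simp [this]
      have h4 : (affinePoint (hr p) (s p) τ).im = r p * τ.im := by
        rw [← UpperHalfPlane.coe_im]
        simp [affinePoint]
      rw [etaHeight, etaHeight, h4] at h2
      change ‖eta ((p.1 : ℂ) * (γ • τ : ℍ) + (p.2 : ℂ) / (h N p.1 : ℂ))‖ ^ 4 *
        (((p.1 : ℂ) * (γ • τ : ℍ) + (p.2 : ℂ) / (h N p.1 : ℂ))).im = _ at h2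
      rw [h3] at h2
      have h5 := (γ • τ : ℍ).im_ne_zero
      rw [etaMK]
      field_simp
      linear_combination h2
    rw [etaProduct, norm_prod, ← Finset.prod_pow]
    have h6 : ∀ p ∈ pairs N, ‖etaMK N p.1 p.2 (γ • τ) ^ e p.1 p.2‖ ^ 4 =
        ((r p / p.1) * ‖eta (affinePoint (hr p) (s p) τ)‖ ^ 4) ^ e p.1 p.2 *
          (τ.im / (γ • τ : ℍ).im) ^ e p.1 p.2 := by
      intro p hp
      rw [norm_zpow, ← mul_zpow, ← h1 p hp, ← zpow_natCast, ← zpow_natCast, zpow_comm]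
    rw [Finset.prod_congr rfl h6, Finset.prod_mul_distrib, prod_zpow_eq_zpow_sum hρ, he, zpow_zero,
      mul_one]
  simp only [key]
  refine ExpGrowth.prod _ (fun p _ τ => ?_) fun p hp => expGrowth_eta_affine (hr p) (s p) _ ?_ _
  · have := hr p
    positivity
  · have : (0 : ℝ) < p.1 := by exact_mod_cast (mem_pairs hN hp).1
    exact div_pos (hr p) this

lemma differentiableAt_etaProduct_smul {N : ℕ} (hN : N ≠ 0) (e : ℕ → ℕ → ℤ) (γ : SL(2, ℤ)) {z : ℂ}
    (hz : 0 < z.im) : DifferentiableAt ℂ (fun z : ℂ => etaProduct N e (γ • ofComplex z)) z := by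
  have hev : (fun z : ℂ => etaProduct N e (γ • ofComplex z)) =ᶠ[nhds z] fun z =>
      ∏ p ∈ pairs N, eta ((p.1 : ℂ) * (((γ 0 0 : ℤ) * z + (γ 0 1 : ℤ)) /
        ((γ 1 0 : ℤ) * z + (γ 1 1 : ℤ))) + (p.2 : ℂ) / (h N p.1 : ℂ)) ^ e p.1 p.2 := by
    filter_upwards [(isOpen_lt continuous_const Complex.continuous_im).mem_nhds hz] with w hw
    simp only [etaProduct, etaMK, coe_smul_eq, ofComplex_apply_of_im_pos hw]
  refine DifferentiableAt.congr_of_eventuallyEq ?_ hev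
  refine DifferentiableAt.fun_finsetProd fun p hp => ?_
  have hden := denom_ne_zero γ hz
  have him := im_etaMK_arg_pos (mem_pairs hN hp).1 p.2 (h N p.1) (γ • (⟨z, hz⟩ : ℍ))
  rw [coe_smul_eq] at him
  have hinner : DifferentiableAt ℂ (fun z : ℂ => (p.1 : ℂ) * (((γ 0 0 : ℤ) * z + (γ 0 1 : ℤ)) /
        ((γ 1 0 : ℤ) * z + (γ 1 1 : ℤ))) + (p.2 : ℂ) / (h N p.1 : ℂ)) z := by
    fun_prop (disch := exact hden)
  refine DifferentiableAt.zpow (DifferentiableAt.comp z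
    (differentiableAt_eta_of_mem_upperHalfPlaneSet him) hinner) (Or.inl ?_)
  exact eta_ne_zero him

lemma meromorphicOn_etaProduct {N : ℕ} (hN : N ≠ 0) (e : ℕ → ℕ → ℤ) :
    MeromorphicOn (fun z : ℂ => etaProduct N e (ofComplex z)) {z : ℂ | 0 < z.im} := by
  have hopen : IsOpen {z : ℂ | 0 < z.im} := isOpen_lt continuous_const Complex.continuous_im
  have hd : DifferentiableOn ℂ (fun z : ℂ => etaProduct N e (ofComplex z)) {z : ℂ | 0 < z.im} := by
    intro z hz
    simpa using (differentiableAt_etaProduct_smul hN e 1 hz).differentiableWithinAt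
  exact (hd.analyticOnNhd hopen).meromorphicOn

/-- A periodic holomorphic function of at most exponential growth is meromorphic in `q` at the
cusp. -/
lemma exists_meromorphicAt_of_expGrowth {N : ℕ} (hN : N ≠ 0) {F : ℍ → ℂ}
    (hper : Function.Periodic (fun z : ℂ => F (ofComplex z)) (N : ℝ))
    (hdiff : ∀ z : ℂ, 0 < z.im → DifferentiableAt ℂ (fun z : ℂ => F (ofComplex z)) z)
    (hgrowth : ExpGrowth fun τ => ‖F τ‖ ^ 4) :
    ∃ g : ℂ → ℂ, MeromorphicAt g 0 ∧
      ∀ τ : ℍ, F τ = g (Function.Periodic.qParam (N : ℝ) (τ : ℂ)) := by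
  obtain ⟨A, C, K, hC, hb⟩ := hgrowth
  have hNpos : (0 : ℝ) < N := by exact_mod_cast Nat.pos_of_ne_zero hN
  -- |q_N|ⁿ = exp(-2πn·Im z/N) beats exp(K·Im z) once n ≥ KN/2π.
  obtain ⟨n, hn⟩ := exists_nat_ge (K * N / (2 * π))
  set f₂ : ℂ → ℂ := fun z => Function.Periodic.qParam (N : ℝ) z ^ n * F (ofComplex z) with hf₂
  have hper₂ : Function.Periodic f₂ (N : ℝ) := by
    intro z
    have h1 : Function.Periodic.qParam (N : ℝ) (z + (N : ℝ)) = Function.Periodic.qParam (N : ℝ) z := by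
      simp only [Function.Periodic.qParam]
      rw [Complex.exp_eq_exp_iff_exists_int]
      have : ((N : ℝ) : ℂ) ≠ 0 := by exact_mod_cast hN
      exact ⟨1, by push_cast at this ⊢; field_simp⟩
    simp only [hf₂, h1]
    rw [show F (ofComplex (z + (N : ℝ))) = F (ofComplex z) from hper z]
  have hdiff₂ : ∀ᶠ z in Filter.comap Complex.im Filter.atTop, DifferentiableAt ℂ f₂ z := by
    filter_upwards [Filter.preimage_mem_comap (Filter.Ioi_mem_atTop 0)] with z hz
    exact ((Function.Periodic.differentiable_qParam z).pow n).mul (hdiff z hz)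
  have hbd : Filter.BoundedAtFilter (Filter.comap Complex.im Filter.atTop) f₂ := by
    refine Asymptotics.IsBigO.of_bound (1 + C) ?_
    filter_upwards [Filter.preimage_mem_comap (Filter.Ioi_mem_atTop (max A 0))] with z hz
    have hz0 : 0 < z.im := (le_max_right _ _).trans_lt hz
    have hzA : A ≤ z.im := (le_max_left _ _).trans (le_of_lt hz)
    have h1 := hb ⟨z, hz0⟩ hzA
    beta_reduce at h1
    change ‖F ⟨z, hz0⟩‖ ^ 4 ≤ C * Real.exp (K * z.im) at h1
    have hq : ‖Function.Periodic.qParam (N : ℝ) z‖ ^ n = Real.exp (-(n * (2 * π * z.im / N))) := by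
      rw [Function.Periodic.norm_qParam, ← Real.exp_nat_mul]
      congr 1
      ring
    have hq1 : Real.exp (-(n * (2 * π * z.im / N))) ≤ 1 := by
      rw [Real.exp_le_one_iff, neg_nonpos]
      positivity
    have hq2 : Real.exp (-(n * (2 * π * z.im / N))) * Real.exp (K * z.im) ≤ 1 := by
      rw [← Real.exp_add, Real.exp_le_one_iff]
      have h2 : K ≤ n * (2 * π / N) := by
        rw [div_le_iff₀ (by positivity)] at hn
        rw [mul_div_assoc', le_div_iff₀ hNpos]
        exact hn
      have h3 : n * (2 * π * z.im / N) = n * (2 * π / N) * z.im := by ring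
      rw [h3]
      nlinarith
    -- A bound on the fourth power bounds ‖F‖ itself wherever ‖F‖ ≥ 1.
    have hF : ‖F ⟨z, hz0⟩‖ ≤ 1 + C * Real.exp (K * z.im) := by
      rcases le_total ‖F ⟨z, hz0⟩‖ 1 with h4 | h4
      · have : 0 ≤ C * Real.exp (K * z.im) := by positivity
        linarith
      · have : ‖F ⟨z, hz0⟩‖ ≤ ‖F ⟨z, hz0⟩‖ ^ 4 := le_self_pow₀ h4 (by norm_num)
        linarith
    simp only [hf₂, norm_mul, norm_pow, Pi.one_apply, norm_one, mul_one,
      ofComplex_apply_of_im_pos hz0, hq]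
    have h5 : 0 < Real.exp (-(n * (2 * π * z.im / N))) := Real.exp_pos _
    calc _ ≤ Real.exp (-(n * (2 * π * z.im / N))) * (1 + C * Real.exp (K * z.im)) :=
          mul_le_mul_of_nonneg_left hF h5.le
      _ = Real.exp (-(n * (2 * π * z.im / N))) +
          C * (Real.exp (-(n * (2 * π * z.im / N))) * Real.exp (K * z.im)) := by ring
      _ ≤ 1 + C * 1 := add_le_add hq1 (mul_le_mul_of_nonneg_left hq2 hC)
      _ = 1 + C := by ring
  have h0 := Function.Periodic.differentiableAt_cuspFunction_zero hNpos hper₂ hdiff₂ hbd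
  have hne := Function.Periodic.eventually_differentiableAt_cuspFunction_nhds_ne_zero hNpos hper₂ hdiff₂
  have han : AnalyticAt ℂ (Function.Periodic.cuspFunction (N : ℝ) f₂) 0 := by
    rw [Complex.analyticAt_iff_eventually_differentiableAt]
    rw [eventually_nhdsWithin_iff] at hne
    filter_upwards [hne] with q hq
    by_cases hq0 : q = 0
    · rw [hq0]
      exact h0
    · exact hq hq0
  refine ⟨fun q => (q ^ n)⁻¹ * Function.Periodic.cuspFunction (N : ℝ) f₂ q, ?_, fun τ => ?_⟩
  · exact ((MeromorphicAt.id 0).pow n).inv.mul han.meromorphicAt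
  · beta_reduce
    rw [Function.Periodic.eq_cuspFunction hNpos.ne' hper₂]
    have : Function.Periodic.qParam (N : ℝ) (τ : ℂ) ^ n ≠ 0 :=
      pow_ne_zero _ (Function.Periodic.qParam_ne_zero _)
    simp only [hf₂, ofComplex_apply]
    rw [inv_mul_cancel_left₀ this]

/-- Γ(N) is normal and lies in Γ₀(N); hence a Γ₀(N)-invariant function has period N at every cusp.
-/
lemma T_conj_mem_Gamma0 (N : ℕ) (γ : SL(2, ℤ)) :
    γ * ModularGroup.T ^ (N : ℤ) * γ⁻¹ ∈ CongruenceSubgroup.Gamma0 N := by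
  have h1 : ModularGroup.T ^ (N : ℤ) ∈ CongruenceSubgroup.Gamma N := by
    rw [CongruenceSubgroup.Gamma_mem]
    rw [ModularGroup.coe_T_zpow]
    simp
  have h2 := (CongruenceSubgroup.Gamma_normal N).conj_mem _ h1 γ
  rw [CongruenceSubgroup.Gamma_mem] at h2
  rw [CongruenceSubgroup.Gamma0_mem]
  exact h2.2.2.1

theorem isModularFunction_etaProduct {N : ℕ} (hN : N ≠ 0) {e : ℕ → ℕ → ℤ}
    (he : ∑ p ∈ pairs N, e p.1 p.2 = 0)
    (hinv : ∀ γ ∈ CongruenceSubgroup.Gamma0 N, ∀ τ : ℍ,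
      etaProduct N e (γ • τ) = etaProduct N e τ) :
    IsModularFunction N (etaProduct N e) := by
  refine ⟨meromorphicOn_etaProduct hN e, hinv, fun γ => ?_⟩
  have hper : ∀ τ : ℍ, etaProduct N e (γ • (ModularGroup.T ^ (N : ℤ) • τ)) =
      etaProduct N e (γ • τ) := by
    intro τ
    rw [← hinv _ (T_conj_mem_Gamma0 N γ) (γ • τ), ← mul_smul, ← mul_smul, inv_mul_cancel_right]
  obtain ⟨g, hg, hF⟩ := exists_meromorphicAt_of_expGrowth hN (F := fun τ => etaProduct N e (γ • τ))
    (by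
      intro z
      by_cases hz : 0 < z.im
      · have hz' : 0 < (z + (N : ℝ) : ℂ).im := by simpa using hz
        have : (ModularGroup.T ^ (N : ℤ) • ofComplex z : ℍ) = ofComplex (z + (N : ℝ)) := by
          ext
          rw [ModularGroup.coe_T_zpow_smul_eq, ofComplex_apply_of_im_pos hz,
            ofComplex_apply_of_im_pos hz']
          simp
        beta_reduce
        rw [← this]
        exact hper _
      -- Off the half-plane `ofComplex` takes one default value, so periodicity is trivial there.
      · have hz' : (z + (N : ℝ) : ℂ).im ≤ 0 := by simpa using hz
        beta_reduce
        rw [ofComplex_apply_eq_of_im_nonpos hz' (not_lt.1 hz)])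
    (fun z hz => differentiableAt_etaProduct_smul hN e γ hz)
    (expGrowth_etaProduct_smul hN he γ)
  exact ⟨g, hg, Filter.Eventually.of_forall hF⟩

/-! ### Prime exponents of ∏ m^e and squares -/

/-- The exponent of the prime `q` in `∏ m ^ e_{m,k}`. -/
def ordSum (N : ℕ) (e : ℕ → ℕ → ℤ) (q : ℕ) : ℤ :=
  ∑ p ∈ pairs N, e p.1 p.2 * (padicValNat q p.1 : ℤ)

lemma prod_primeFactors_pow {N m : ℕ} (hN : N ≠ 0) (hm : m ∣ N) :
    ∏ q ∈ N.primeFactors, q ^ padicValNat q m = m := by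
  have hm0 : m ≠ 0 := by
    rintro rfl
    exact hN (zero_dvd_iff.1 hm)
  conv_rhs => rw [← Nat.prod_factorization_pow_eq_self hm0]
  rw [Finsupp.prod_of_support_subset _ (Nat.primeFactors_mono hm hN) _ (by simp)]
  exact Finset.prod_congr rfl fun q hq => by
    rw [Nat.factorization_def _ (Nat.prime_of_mem_primeFactors hq)]

/-- Applied both to the inclusion in ℚ and to the Jacobi symbol, this expresses the square condition
and the character through the same exponents. -/
lemma prod_pairs_eq_prod_primeFactors {G : Type*} [CommGroupWithZero G] {N : ℕ} (hN : N ≠ 0)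
    (e : ℕ → ℕ → ℤ) (F : ℕ →* G) (hF : ∀ q ∈ N.primeFactors, F q ≠ 0) :
    ∏ p ∈ pairs N, F p.1 ^ e p.1 p.2 = ∏ q ∈ N.primeFactors, F q ^ ordSum N e q := by
  have h1 : ∀ p ∈ pairs N, F p.1 ^ e p.1 p.2 =
      ∏ q ∈ N.primeFactors, F q ^ (e p.1 p.2 * (padicValNat q p.1 : ℤ)) := by
    intro p hp
    have h2 : F p.1 = ∏ q ∈ N.primeFactors, F q ^ padicValNat q p.1 := by
      conv_lhs => rw [← prod_primeFactors_pow hN (mem_pairs hN hp).2.1]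
      simp only [map_prod, map_pow]
    rw [h2, ← Finset.prod_zpow]
    refine Finset.prod_congr rfl fun q _ => ?_
    rw [← zpow_natCast, ← zpow_mul, mul_comm]
  rw [Finset.prod_congr rfl h1, Finset.prod_comm]
  exact Finset.prod_congr rfl fun q hq => prod_zpow_eq_zpow_sum (hF q hq) _ _

lemma padicValRat_prod_primes (S : Finset ℕ) (hS : ∀ q ∈ S, q.Prime) (x : ℕ → ℤ) {r : ℕ}
    (hr : r.Prime) :
    padicValRat r (∏ q ∈ S, (q : ℚ) ^ x q) = if r ∈ S then x r else 0 := by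
  have : Fact r.Prime := ⟨hr⟩
  induction S using Finset.induction_on with
  | empty => simp
  | insert q S hq ih =>
    have hqp := hS q (Finset.mem_insert_self q S)
    have hq0 : (q : ℚ) ^ x q ≠ 0 := zpow_ne_zero _ (by exact_mod_cast hqp.ne_zero)
    have hS0 : ∏ q ∈ S, (q : ℚ) ^ x q ≠ 0 := Finset.prod_ne_zero_iff.2 fun q' hq' =>
      zpow_ne_zero _ (by exact_mod_cast (hS q' (Finset.mem_insert_of_mem hq')).ne_zero)
    rw [Finset.prod_insert hq, padicValRat.mul hq0 hS0,
      ih fun q' hq' => hS q' (Finset.mem_insert_of_mem hq'),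
      padicValRat.zpow,
      padicValRat.of_nat]
    by_cases hrq : r = q
    · subst hrq
      simp [hq]
    · have : Fact q.Prime := ⟨hqp⟩
      rw [padicValNat_primes hrq]
      simp [hrq]

lemma isSquare_prod_primes_iff (S : Finset ℕ) (hS : ∀ q ∈ S, q.Prime) (x : ℕ → ℤ) :
    IsSquare (∏ q ∈ S, (q : ℚ) ^ x q) ↔ ∀ q ∈ S, Even (x q) := by
  constructor
  · rintro ⟨r, hr⟩ q hq
    have : Fact q.Prime := ⟨hS q hq⟩
    have h1 := padicValRat_prod_primes S hS x (hS q hq)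
    rw [if_pos hq, hr] at h1
    have hr0 : r ≠ 0 := by
      rintro rfl
      rw [mul_zero, Finset.prod_eq_zero_iff] at hr
      obtain ⟨q', hq', h0⟩ := hr
      exact zpow_ne_zero _ (by exact_mod_cast (hS q' hq').ne_zero) h0
    rw [padicValRat.mul hr0 hr0] at h1
    exact ⟨_, h1.symm⟩
  · intro hx
    refine Finset.isSquare_prod _ fun q hq => ?_
    obtain ⟨y, hy⟩ := hx q hq
    rw [hy, zpow_add₀ (by exact_mod_cast (hS q hq).ne_zero)]
    exact ⟨_, rfl⟩

lemma prod_pairs_rat {N : ℕ} (hN : N ≠ 0) (e : ℕ → ℕ → ℤ) :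
    ∏ p ∈ pairs N, (p.1 : ℚ) ^ e p.1 p.2 = ∏ q ∈ N.primeFactors, (q : ℚ) ^ ordSum N e q :=
  prod_pairs_eq_prod_primeFactors hN e (Nat.castRingHom ℚ : ℕ →* ℚ) fun q hq => by
    simpa using (Nat.prime_of_mem_primeFactors hq).ne_zero

lemma isSquare_prod_pairs_iff {N : ℕ} (hN : N ≠ 0) (e : ℕ → ℕ → ℤ) :
    IsSquare (∏ p ∈ pairs N, (p.1 : ℚ) ^ e p.1 p.2) ↔
      ∀ q ∈ N.primeFactors, Even (ordSum N e q) := by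
  rw [prod_pairs_rat hN, isSquare_prod_primes_iff _ fun q hq => Nat.prime_of_mem_primeFactors hq]

lemma isSquare_oddPart_prod_pairs_iff {N : ℕ} (hN : N ≠ 0) (e : ℕ → ℕ → ℤ) :
    IsSquare (oddPart (∏ p ∈ pairs N, (p.1 : ℚ) ^ e p.1 p.2)) ↔
      ∀ q ∈ N.primeFactors, q ≠ 2 → Even (ordSum N e q) := by
  have hprime : ∀ q ∈ N.primeFactors.erase 2, q.Prime := fun q hq =>
    Nat.prime_of_mem_primeFactors (Finset.mem_of_mem_erase hq)
  have h1 : oddPart (∏ p ∈ pairs N, (p.1 : ℚ) ^ e p.1 p.2) =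
      ∏ q ∈ N.primeFactors.erase 2, (q : ℚ) ^ ordSum N e q := by
    have h2 := padicValRat_prod_primes N.primeFactors
      (fun q hq => Nat.prime_of_mem_primeFactors hq) (ordSum N e) Nat.prime_two
    rw [oddPart, prod_pairs_rat hN, h2]
    by_cases hmem : 2 ∈ N.primeFactors
    · rw [if_pos hmem, ← Finset.mul_prod_erase _ _ hmem]
      have : ((2 : ℕ) : ℚ) ^ ordSum N e 2 ≠ 0 := zpow_ne_zero _ (by norm_num)
      rw [Nat.cast_two] at this ⊢
      rw [mul_div_cancel_left₀ _ this]
    · rw [if_neg hmem, zpow_zero, div_one, Finset.erase_eq_of_notMem hmem]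
  rw [h1, isSquare_prod_primes_iff _ hprime]
  simp only [Finset.mem_erase]
  exact ⟨fun H q hq h2 => H q ⟨h2, hq⟩, fun H q hq => H q hq.2 hq.1⟩

/-! ### Jacobi symbols at the primes of N and test values of d -/

/-- The Jacobi symbol as a multiplicative function of its numerator. -/
def jacobiHom (d : ℕ) : ℕ →* ℂ where
  toFun m := (J(m | d) : ℂ)
  map_one' := by simp
  map_mul' x y := by
    push_cast
    rw [jacobiSym.mul_left]
    push_cast
    rfl

lemma prod_jacobi_eq {N : ℕ} (hN : N ≠ 0) (e : ℕ → ℕ → ℤ) {d : ℕ} (hd : d.Coprime N) :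
    ∏ p ∈ pairs N, (J(p.1 | d) : ℂ) ^ e p.1 p.2 =
      ∏ q ∈ N.primeFactors, (J(q | d) : ℂ) ^ ordSum N e q := by
  refine prod_pairs_eq_prod_primeFactors hN e (jacobiHom d) fun q hq => ?_
  have : (q : ℤ).gcd d = 1 := by
    rw [Int.gcd_natCast_natCast]
    exact (hd.symm).coprime_dvd_left (Nat.dvd_of_mem_primeFactors hq)
  have h0 := jacobiSym.ne_zero this
  change (J(q | d) : ℂ) ≠ 0
  exact_mod_cast h0

lemma jacobi_zpow_eq_one_of_even {q d : ℕ} (h : q.Coprime d) {x : ℤ} (hx : Even x) :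
    (J(q | d) : ℂ) ^ x = 1 := by
  obtain ⟨y, rfl⟩ := hx
  have : (J(q | d) : ℂ) ^ 2 = 1 := by
    exact_mod_cast jacobiSym.sq_one (a := q) (b := d) (by rwa [Int.gcd_natCast_natCast])
  rw [← two_mul, zpow_mul]
  rw [show (J(q | d) : ℂ) ^ (2 : ℤ) = 1 by exact_mod_cast this, one_zpow]

/-- (2/d) = (-1)^((d² - 1)/8), and (d² - 1)/8 = 3D has the parity of D. Hence the power of 2 in ∏
m^e mixes with the sum over k. -/
lemma jacobiSym_two_eq {d : ℕ} (hd : Odd d) {D : ℤ} (hD : (d : ℤ) ^ 2 - 1 = 24 * D) :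
    (J(2 | d) : ℂ) = zeta ^ (12 * D) := by
  rw [zpow_mul, zeta_zpow_twelve, jacobiSym.at_two hd, ZMod.χ₈_nat_eq_if_mod_eight]
  obtain ⟨j, hj⟩ : ∃ j : ℤ, (d : ℤ) = 8 * j + (d % 8 : ℕ) := ⟨d / 8, by omega⟩
  have h8 : d % 8 = 1 ∨ d % 8 = 3 ∨ d % 8 = 5 ∨ d % 8 = 7 := by
    have := Nat.odd_iff.1 hd
    omega
  have hd2 : d % 2 ≠ 0 := by omega
  rw [if_neg hd2]
  rw [hj] at hD
  rcases h8 with h | h | h | h <;> rw [h] at hD ⊢ <;> push_cast at hD <;> ring_nf at hD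
  · have : Even D := by
      rw [Int.even_iff]; omega
    simp [this.neg_one_zpow]
  · have : Odd D := by
      rw [Int.odd_iff]; omega
    simp [this.neg_one_zpow]
  · have : Odd D := by
      rw [Int.odd_iff]; omega
    simp [this.neg_one_zpow]
  · have : Even D := by
      rw [Int.even_iff]; omega
    simp [this.neg_one_zpow]

lemma jacobiSym_eq_one_of_modEq_one {q d : ℕ} (hq : q.Prime) (h8 : d % 8 = 1)
    (hd : d ≡ 1 [MOD q]) : J(q | d) = 1 := by
  rcases hq.eq_two_or_odd' with rfl | hodd
  · rw [Nat.cast_two, jacobiSym.at_two (Nat.odd_iff.2 (by omega)), ZMod.χ₈_nat_eq_if_mod_eight]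
    simp [h8]
    omega
  · rw [jacobiSym.quadratic_reciprocity_one_mod_four' hodd (by omega)]
    rw [jacobiSym.mod_left' (a₂ := 1) (by exact_mod_cast hd), jacobiSym.one_left]

/-- For p = 3 the residue is lifted to 8 ≡ -1 modulo 9, a nonresidue modulo 3 whose square is still
1 modulo 9. -/
lemma exists_nonresidue {p : ℕ} (hp : p.Prime) (hp2 : p ≠ 2) : ∃ u p' : ℕ, J(u | p) = -1 ∧
    p ∣ p' ∧ p' ∣ p ^ 2 ∧ (p = 3 → p' = 9 ∧ u = 8) := by
  by_cases h3 : p = 3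
  · subst h3
    refine ⟨8, 9, ?_, by norm_num, by norm_num, fun _ => ⟨rfl, rfl⟩⟩
    rw [jacobiSym.mod_left' (a₂ := 2) (by norm_num), jacobiSym.at_two (by decide)]
    rfl
  · have : Fact p.Prime := ⟨hp⟩
    obtain ⟨a, ha⟩ := FiniteField.exists_nonsquare (F := ZMod p) (by rwa [ZMod.ringChar_zmod_n])
    refine ⟨a.val, p, ?_, dvd_rfl, dvd_pow_self _ two_ne_zero, fun h => absurd h h3⟩
    rw [← jacobiSym.legendreSym.to_jacobiSym, legendreSym.eq_neg_one_iff]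
    simpa using ha

/-- An integer detecting the parity of the exponent of a given odd prime. -/
lemma exists_detecting {N p : ℕ} (hN : N ≠ 0) (hp : p.Prime) (hp2 : p ≠ 2) :
    ∃ d : ℕ, Odd d ∧ ¬ 3 ∣ d ∧ d.Coprime N ∧ (576 : ℤ) ∣ (d : ℤ) ^ 2 - 1 ∧ J(p | d) = -1 ∧
      ∀ q, q.Prime → q ∣ N → q ≠ p → J(q | d) = 1 := by
  obtain ⟨u, p', hu, hpp', hp'p, h3⟩ := exists_nonresidue hp hp2
  have h0 : 576 * N ≠ 0 := by omega
  set v := (576 * N).factorization p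
  set R := (576 * N) / p ^ v with hR
  have hRmul : p ^ v * R = 576 * N := Nat.ordProj_mul_ordCompl_eq_self _ _
  have hcop : Nat.Coprime p R := Nat.coprime_ordCompl hp h0
  have hcop' : Nat.Coprime R p' := Nat.Coprime.coprime_dvd_right hp'p (hcop.symm.pow_right 2)
  have hdvd : ∀ x : ℕ, x.Coprime p → x ∣ 576 * N → x ∣ R := fun x hx hxN =>
    (hx.pow_right v).dvd_of_dvd_mul_left (hRmul ▸ hxN)
  -- R is the part of 576N prime to p; as 576 = 24², d² ≡ 1 modulo 576 means 24 ∣ D and kills the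
  -- power of ζ. Since 64 ∣ R, reciprocity costs no sign.
  obtain ⟨d, hd1, hdu⟩ := Nat.chineseRemainder hcop' 1 u
  have hp2' : Nat.Coprime 2 p := (Nat.coprime_primes Nat.prime_two hp).2 (Ne.symm hp2)
  have h64 : 64 ∣ R := hdvd 64 (by simpa using hp2'.pow_left 6) ⟨9 * N, by ring⟩
  have hd64 : d % 64 = 1 := hd1.of_dvd h64
  have hdp : d ≡ u [MOD p] := hdu.of_dvd hpp'
  have hJp : J(p | d) = -1 := by
    rw [jacobiSym.quadratic_reciprocity_one_mod_four' (hp.odd_of_ne_two hp2) (by omega), ← hu]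
    exact jacobiSym.mod_left' (by exact_mod_cast hdp)
  have hpd : ¬ p ∣ d := by
    intro hcon
    have h1 : (p : ℤ).gcd d ≠ 1 := by
      rw [Int.gcd_natCast_natCast, Nat.gcd_eq_left hcon]
      exact hp.one_lt.ne'
    have h2 : d ≠ 0 := by omega
    rw [jacobiSym.eq_zero_iff.2 ⟨h2, h1⟩] at hJp
    norm_num at hJp
  have hq1 : ∀ q, q.Prime → q ∣ 576 * N → q ≠ p → d ≡ 1 [MOD q] := fun q hq hqN hqp =>
    hd1.of_dvd (hdvd q ((Nat.coprime_primes hq hp).2 hqp) hqN)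
  have hd9 : (d : ℤ) % 9 = 1 ∨ (d : ℤ) % 9 = 8 := by
    by_cases hp3 : p = 3
    · obtain ⟨rfl, rfl⟩ := h3 hp3
      have : d % 9 = 8 := hdu
      omega
    · have h9 : 9 ∣ R := hdvd 9 (by
        simpa using ((Nat.coprime_primes Nat.prime_three hp).2 (Ne.symm hp3)).pow_left 2) ⟨64 * N, by ring⟩
      have : d % 9 = 1 := hd1.of_dvd h9
      omega
  refine ⟨d, Nat.odd_iff.2 (by omega), by omega, ?_, ?_, hJp, fun q hq hqN hqp =>
    jacobiSym_eq_one_of_modEq_one hq (by omega) (hq1 q hq (hqN.mul_left _) hqp)⟩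
  · refine Nat.Coprime.symm (Nat.coprime_of_dvd fun q hq hqN hqd => ?_)
    by_cases hqp : q = p
    · exact hpd (hqp ▸ hqd)
    · have h1 := hq1 q hq (hqN.mul_left _) hqp
      have h2 : 0 ≡ 1 [MOD q] := ((Nat.modEq_zero_iff_dvd.2 hqd).symm).trans h1
      exact hq.one_lt.ne' (Nat.dvd_one.1 ((Nat.modEq_iff_dvd' (Nat.zero_le 1)).1 h2))
  · have e64 : (64 : ℤ) ∣ (d : ℤ) ^ 2 - 1 := by
      rw [show (d : ℤ) ^ 2 - 1 = (d - 1) * (d + 1) by ring]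
      exact (show (64 : ℤ) ∣ (d : ℤ) - 1 by omega).mul_right _
    have e9 : (9 : ℤ) ∣ (d : ℤ) ^ 2 - 1 := by
      rw [show (d : ℤ) ^ 2 - 1 = (d - 1) * (d + 1) by ring]
      rcases hd9 with h | h
      · exact (show (9 : ℤ) ∣ (d : ℤ) - 1 by omega).mul_right _
      · exact (show (9 : ℤ) ∣ (d : ℤ) + 1 by omega).mul_left _
    omega

/-- An integer detecting the parity of the exponent of `2`. -/
lemma exists_detecting_two {N : ℕ} (hN : N ≠ 0) :
    ∃ d : ℕ, Odd d ∧ ¬ 3 ∣ d ∧ d.Coprime N ∧ (9 : ℤ) ∣ (d : ℤ) ^ 2 - 1 ∧ J(2 | d) = -1 ∧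
      ∀ q, q.Prime → q ∣ N → q ≠ 2 → J(q | d) = 1 := by
  set v := (9 * N).factorization 2
  set R := (9 * N) / 2 ^ v with hR
  have h0 : 9 * N ≠ 0 := by omega
  have hRmul : 2 ^ v * R = 9 * N := Nat.ordProj_mul_ordCompl_eq_self _ _
  have hcop : Nat.Coprime 2 R := Nat.coprime_ordCompl Nat.prime_two h0
  have hRodd : R % 2 = 1 := Nat.odd_iff.1 (Nat.coprime_two_left.1 hcop)
  have hdvd : ∀ x : ℕ, x.Coprime 2 → x ∣ 9 * N → x ∣ R := fun x hx hxN =>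
    (hx.pow_right v).dvd_of_dvd_mul_left (hRmul ▸ hxN)
  have h9 : 9 ∣ R := hdvd 9 (by norm_num) ⟨N, rfl⟩
  have hq1 : ∀ q, q ∣ R → 1 + 4 * R ≡ 1 [MOD q] := fun q hq => by
    have := (Nat.modEq_zero_iff_dvd.2 (hq.mul_left 4)).add_left 1
    simpa using this
  have hqR : ∀ q, q.Prime → q ∣ N → q ≠ 2 → q ∣ R := fun q hq hqN hq2 =>
    hdvd q ((Nat.coprime_primes hq Nat.prime_two).2 hq2) (hqN.mul_left _)
  -- R is odd, so 1 + 4R ≡ 5 modulo 8 and 2 is a nonresidue; modulo 9 and modulo every odd prime of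
  -- N it is 1.
  refine ⟨1 + 4 * R, Nat.odd_iff.2 (by omega), by omega, ?_, ?_, ?_, ?_⟩
  · refine Nat.Coprime.symm (Nat.coprime_of_dvd fun q hq hqN hqd => ?_)
    by_cases hqp : q = 2
    · subst hqp
      omega
    · have h1 := hq1 q (hqR q hq hqN hqp)
      have h2 : 0 ≡ 1 [MOD q] := ((Nat.modEq_zero_iff_dvd.2 hqd).symm).trans h1
      exact hq.one_lt.ne' (Nat.dvd_one.1 ((Nat.modEq_iff_dvd' (Nat.zero_le 1)).1 h2))
  · obtain ⟨r, hr⟩ := h9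
    rw [hr]
    push_cast
    exact ⟨8 * r + 144 * r ^ 2, by ring⟩
  · rw [jacobiSym.at_two (Nat.odd_iff.2 (by omega)), ZMod.χ₈_nat_eq_if_mod_eight,
      if_neg (by omega), if_neg (by omega)]
  · intro q hq hqN hq2
    rw [jacobiSym.quadratic_reciprocity_one_mod_four' (hq.odd_of_ne_two hq2) (by omega),
      jacobiSym.mod_left' (a₂ := 1) (by exact_mod_cast hq1 q (hqR q hq hqN hq2)),
      jacobiSym.one_left]

lemma exists_five_mod {N : ℕ} (hN : N ≠ 0) : ∃ d : ℕ, d % 144 = 5 ∧ d.Coprime N := by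
  set v := N.factorization 2
  set R := N / 2 ^ v with hR
  have hRmul : 2 ^ v * R = N := Nat.ordProj_mul_ordCompl_eq_self _ _
  have hcop : Nat.Coprime 2 R := Nat.coprime_ordCompl Nat.prime_two hN
  have hR0 : R ≠ 0 := by
    rintro h
    rw [h] at hRmul
    omega
  set w := R.factorization 3
  set Q := R / 3 ^ w with hQ
  have hQmul : 3 ^ w * Q = R := Nat.ordProj_mul_ordCompl_eq_self _ _
  have hcop3 : Nat.Coprime 3 Q := Nat.coprime_ordCompl Nat.prime_three hR0
  have hcop2 : Nat.Coprime 2 Q := hcop.coprime_dvd_right ⟨3 ^ w, by rw [← hQmul]; ring⟩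
  have hc : Nat.Coprime 144 Q := by
    rw [show 144 = 2 ^ 4 * 3 ^ 2 by norm_num]
    exact (hcop2.pow_left 4).mul_left (hcop3.pow_left 2)
  obtain ⟨d, hd5, hd1⟩ := Nat.chineseRemainder hc 5 1
  have hd5' : d % 144 = 5 := hd5
  refine ⟨d, hd5', ?_⟩
  rw [← hRmul, ← hQmul]
  have c2 : d.Coprime 2 := Nat.coprime_two_right.2 (Nat.odd_iff.2 (by omega))
  have c3 : d.Coprime 3 := ((Nat.Prime.coprime_iff_not_dvd Nat.prime_three).2 (by omega)).symm
  have cQ : d.Coprime Q := by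
    have := hd1.gcd_eq
    simpa [Nat.Coprime] using this
  exact (c2.pow_right v).mul_right ((c3.pow_right w).mul_right cQ)

/-! ### Triviality of the character -/

/-- The integer `∑ e_{m,k} · 24 k / h(m)`. -/
def shiftSum (N : ℕ) (e : ℕ → ℕ → ℤ) : ℤ :=
  ∑ p ∈ pairs N, e p.1 p.2 * (p.2 * (24 / h N p.1 : ℕ))

lemma etaCharacter_eq {N : ℕ} (hN : N ≠ 0) (e : ℕ → ℕ → ℤ) {d : ℕ} (hd : d.Coprime N) (D : ℤ) :
    etaCharacter N e d D =
      (∏ q ∈ N.primeFactors, (J(q | d) : ℂ) ^ ordSum N e q) * zeta ^ (D * shiftSum N e) := by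
  rw [etaCharacter, prod_jacobi_eq hN e hd, shiftSum]

lemma coprime_of_mem_primeFactors {N q d : ℕ} (hd : d.Coprime N) (hq : q ∈ N.primeFactors) :
    q.Coprime d :=
  hd.symm.coprime_dvd_left (Nat.dvd_of_mem_primeFactors hq)

lemma even_of_neg_one_zpow {x : ℤ} (h : (-1 : ℂ) ^ x = 1) : Even x := by
  by_contra hx
  rw [Int.not_even_iff_odd] at hx
  rw [hx.neg_one_zpow] at h
  norm_num at h

/-- The condition that the character is trivial on all admissible lower right entries. -/
def TrivialCharacter (N : ℕ) (e : ℕ → ℕ → ℤ) : Prop :=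
  ∀ (d : ℕ) (D : ℤ), Odd d → ¬ 3 ∣ d → d.Coprime N → (d : ℤ) ^ 2 - 1 = 24 * D →
    etaCharacter N e d D = 1

lemma even_ordSum_of_detecting {N : ℕ} (hN : N ≠ 0) {e : ℕ → ℕ → ℤ} {p d : ℕ} {D : ℤ}
    (hp : p ∈ N.primeFactors) (hd : d.Coprime N) (hchar : etaCharacter N e d D = 1)
    (hD : (24 : ℤ) ∣ D * shiftSum N e) (hJ : J(p | d) = -1)
    (hq : ∀ q, q.Prime → q ∣ N → q ≠ p → J(q | d) = 1) : Even (ordSum N e p) := by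
  rw [etaCharacter_eq hN e hd, (zeta_zpow_eq_one_iff _).2 hD, mul_one,
    Finset.prod_eq_single_of_mem p hp fun q hqN hqp => by
      rw [hq q (Nat.prime_of_mem_primeFactors hqN) (Nat.dvd_of_mem_primeFactors hqN) hqp]
      simp, hJ] at hchar
  exact even_of_neg_one_zpow (by simpa using hchar)

lemma even_ordSum_of_trivialCharacter {N : ℕ} (hN : N ≠ 0) {e : ℕ → ℕ → ℤ}
    (H : TrivialCharacter N e) {p : ℕ} (hp : p ∈ N.primeFactors) (hp2 : p ≠ 2) :
    Even (ordSum N e p) := by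
  obtain ⟨d, hd, hd3, hcop, ⟨t, ht⟩, hJ, hq⟩ :=
    exists_detecting hN (Nat.prime_of_mem_primeFactors hp) hp2
  exact even_ordSum_of_detecting hN hp hcop (H d (24 * t) hd hd3 hcop (by rw [ht]; ring))
    ⟨t * shiftSum N e, by ring⟩ hJ hq

lemma prod_jacobi_eq_one {N : ℕ} {e : ℕ → ℕ → ℤ} (hx : ∀ q ∈ N.primeFactors, Even (ordSum N e q))
    {d : ℕ} (hd : d.Coprime N) :
    ∏ q ∈ N.primeFactors, (J(q | d) : ℂ) ^ ordSum N e q = 1 :=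
  Finset.prod_eq_one fun _ hq =>
    jacobi_zpow_eq_one_of_even (coprime_of_mem_primeFactors hd hq) (hx _ hq)

lemma prod_jacobi_eq_two {N : ℕ} {e : ℕ → ℕ → ℤ} (h2 : 2 ∈ N.primeFactors)
    (hx : ∀ q ∈ N.primeFactors, q ≠ 2 → Even (ordSum N e q)) {d : ℕ} (hodd : Odd d)
    (hd : d.Coprime N) {D : ℤ} (hD : (d : ℤ) ^ 2 - 1 = 24 * D) :
    ∏ q ∈ N.primeFactors, (J(q | d) : ℂ) ^ ordSum N e q = zeta ^ (D * (12 * ordSum N e 2)) := by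
  rw [Finset.prod_eq_single_of_mem 2 h2 fun q hq hq2 =>
    jacobi_zpow_eq_one_of_even (coprime_of_mem_primeFactors hd hq) (hx _ hq hq2), Nat.cast_two,
    jacobiSym_two_eq hodd hD, ← zpow_mul]
  congr 1
  ring

/-- d = 5 has D = 1, and d ≡ 5 modulo 144 keeps D ≡ 1 modulo 12. As D is prime to 24, it can be
cancelled from 24 ∣ D·x. -/
lemma exists_five_mod_witness {N : ℕ} (hN : N ≠ 0) : ∃ (d : ℕ) (D : ℤ), Odd d ∧ ¬ 3 ∣ d ∧
    d.Coprime N ∧ (d : ℤ) ^ 2 - 1 = 24 * D ∧ IsCoprime (24 : ℤ) D := by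
  obtain ⟨d, hd, hcop⟩ := exists_five_mod hN
  obtain ⟨j, hj⟩ : ∃ j : ℤ, (d : ℤ) = 144 * j + 5 := ⟨d / 144, by omega⟩
  refine ⟨d, 1 + 12 * (5 * j + 72 * j ^ 2), Nat.odd_iff.2 (by omega), by omega, hcop, by rw [hj]; ring, ?_⟩
  have h1 : IsCoprime (12 : ℤ) (1 + 12 * (5 * j + 72 * j ^ 2)) :=
    ⟨-(5 * j + 72 * j ^ 2), 1, by ring⟩
  have h2 : IsCoprime (2 : ℤ) (1 + 12 * (5 * j + 72 * j ^ 2)) :=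
    h1.of_isCoprime_of_dvd_left ⟨6, by norm_num⟩
  simpa using h2.mul_left h1

/-- Once the odd primes have even exponents, the character is ζ^(D(K + 12·ord₂)), K being
`shiftSum`; a D prime to 24 detects the bracket. -/
theorem trivialCharacter_iff_of_even {N : ℕ} (hN : N ≠ 0) (h2 : 2 ∣ N) (e : ℕ → ℕ → ℤ) :
    TrivialCharacter N e ↔ (24 : ℤ) ∣ shiftSum N e + 12 * ordSum N e 2 ∧
      ∀ q ∈ N.primeFactors, q ≠ 2 → Even (ordSum N e q) := by
  have h2' : 2 ∈ N.primeFactors := Nat.mem_primeFactors.2 ⟨Nat.prime_two, h2, hN⟩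
  have key : (∀ q ∈ N.primeFactors, q ≠ 2 → Even (ordSum N e q)) → ∀ (d : ℕ) (D : ℤ), Odd d →
      d.Coprime N → (d : ℤ) ^ 2 - 1 = 24 * D →
      etaCharacter N e d D = zeta ^ (D * (shiftSum N e + 12 * ordSum N e 2)) := by
    intro hx d D hodd hcop hD
    rw [etaCharacter_eq hN e hcop, prod_jacobi_eq_two h2' hx hodd hcop hD,
      ← zpow_add₀ zeta_ne_zero]
    congr 1
    ring
  constructor
  · intro H
    have hx : ∀ q ∈ N.primeFactors, q ≠ 2 → Even (ordSum N e q) := fun q hq hq2 =>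
      even_ordSum_of_trivialCharacter hN H hq hq2
    refine ⟨?_, hx⟩
    obtain ⟨d, D, hodd, hd3, hcop, hD, hc⟩ := exists_five_mod_witness hN
    have h1 := H d D hodd hd3 hcop hD
    rw [key hx d D hodd hcop hD, zeta_zpow_eq_one_iff] at h1
    exact hc.dvd_of_dvd_mul_left h1
  · rintro ⟨hK, hx⟩ d D hodd _ hcop hD
    rw [key hx d D hodd hcop hD, zeta_zpow_eq_one_iff]
    exact hK.mul_left _

/-- With 8 ∣ K, any d with 3 ∣ D kills the power of ζ, so the parity of the exponent of 2 can be
read off separately. -/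
theorem trivialCharacter_iff_of_eight_dvd {N : ℕ} (hN : N ≠ 0) (e : ℕ → ℕ → ℤ)
    (h8 : (8 : ℤ) ∣ shiftSum N e) :
    TrivialCharacter N e ↔ (24 : ℤ) ∣ shiftSum N e ∧
      ∀ q ∈ N.primeFactors, Even (ordSum N e q) := by
  constructor
  · intro H
    have hx : ∀ q ∈ N.primeFactors, Even (ordSum N e q) := by
      intro q hq
      by_cases hq2 : q = 2
      · subst hq2
        obtain ⟨d, hd, hd3, hcop, h9, hJ, hq'⟩ := exists_detecting_two hN
        obtain ⟨D, hD⟩ := exists_sq_sub_one hd hd3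
        refine even_ordSum_of_detecting hN hq hcop (H d D hd hd3 hcop hD) ?_ (by simpa using hJ) hq'
        obtain ⟨y, hy⟩ := h8
        have h3 : (3 : ℤ) ∣ D := by omega
        obtain ⟨x, hx⟩ := h3
        exact ⟨x * y, by rw [hx, hy]; ring⟩
      · exact even_ordSum_of_trivialCharacter hN H hq hq2
    refine ⟨?_, hx⟩
    obtain ⟨d, D, hodd, hd3, hcop, hD, hc⟩ := exists_five_mod_witness hN
    have h1 := H d D hodd hd3 hcop hD
    rw [etaCharacter_eq hN e hcop, prod_jacobi_eq_one hx hcop, one_mul, zeta_zpow_eq_one_iff] at h1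
    exact hc.dvd_of_dvd_mul_left h1
  · rintro ⟨hK, hx⟩ d D hodd _ hcop hD
    rw [etaCharacter_eq hN e hcop, prod_jacobi_eq_one hx hcop, one_mul, zeta_zpow_eq_one_iff]
    exact hK.mul_left _

/-! ### Translation into conditions (a)–(d) -/

/-- An integral multiple `r z` of a rational is divisible by `r c` iff `c ∣ z`. -/
lemma rat_modEq_zero_iff {r c : ℚ} {z c' : ℤ} (hr : r ≠ 0) (hc : c = r * c') :
    r * z ≡ 0 [PMOD c] ↔ c' ∣ z := by
  rw [AddCommGroup.modEq_zero_iff_eq_zsmul]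
  refine exists_congr fun t => ?_
  rw [hc, zsmul_eq_mul, mul_left_comm, mul_right_inj' hr, mul_comm (t : ℚ)]
  exact_mod_cast Iff.rfl

end ModularUnits

end

theorem theorem1 (n M N : ℕ) (hn : n ∣ 24) (hM : Squarefree M) (hN : N = n ^ 2 * M)
    (e : ℕ → ℕ → ℤ) :
    ModularUnits.IsModularFunction N (ModularUnits.etaProduct N e) ↔
      -- (a)
      (∑ p ∈ ModularUnits.pairs N, e p.1 p.2 = 0) ∧
      -- (b)
      (∑ p ∈ ModularUnits.pairs N, e p.1 p.2 * (p.1 : ℤ) ≡ 0 [ZMOD 24]) ∧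
      -- (c)
      (∑ p ∈ ModularUnits.pairs N, (e p.1 p.2 : ℚ) *
          ((N : ℚ) * (Nat.gcd (ModularUnits.h N p.1) p.2 : ℚ) ^ 2 /
            ((p.1 : ℚ) * (ModularUnits.h N p.1 : ℚ) ^ 2)) ≡ 0 [PMOD (24 : ℚ)]) ∧
      -- (d), n odd
      (Odd n →
        (∑ p ∈ ModularUnits.pairs N, e p.1 p.2 * (p.2 : ℤ) ≡ 0 [ZMOD 3]) ∧
        IsSquare (∏ p ∈ ModularUnits.pairs N, (p.1 : ℚ) ^ e p.1 p.2)) ∧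
      -- (d), n even
      (Even n →
        (∑ p ∈ ModularUnits.pairs N, (e p.1 p.2 : ℚ) *
            ((p.2 : ℚ) * (n : ℚ) / (ModularUnits.h N p.1 : ℚ) +
              (n : ℚ) / 2 * (padicValNat 2 p.1 : ℚ)) ≡ 0 [PMOD (n : ℚ)]) ∧
        IsSquare (ModularUnits.oddPart
          (∏ p ∈ ModularUnits.pairs N, (p.1 : ℚ) ^ e p.1 p.2))) := by
  have hn0 : n ≠ 0 := by
    rintro rfl
    norm_num at hn
  have hN0 : N ≠ 0 := hN ▸ mul_ne_zero (pow_ne_zero 2 hn0) hM.ne_zero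
  have hhn : ∀ m, m ∣ N → ModularUnits.h N m ∣ n := fun m hm => ModularUnits.h_dvd hM hN hN0 hm
  have hh : ∀ m, m ∣ N → ModularUnits.h N m ∣ 24 := fun m hm => (hhn m hm).trans hn
  -- Invariance already forces (a), which the growth estimate at the cusps needs.
  have hmod : ModularUnits.IsModularFunction N (ModularUnits.etaProduct N e) ↔
      ∀ γ ∈ CongruenceSubgroup.Gamma0 N, ∀ τ : ℍ,
        ModularUnits.etaProduct N e (γ • τ) = ModularUnits.etaProduct N e τ :=
    ⟨fun H => H.invariant, fun H => ModularUnits.isModularFunction_etaProduct hN0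
      (ModularUnits.sum_eq_zero_of_invariant hN0 hh H) H⟩
  rw [hmod, ModularUnits.invariant_iff hN0 hh e]
  refine and_congr_right fun _ => and_congr Int.modEq_zero_iff_dvd.symm (and_congr ?_ ?_)
  · rw [← ModularUnits.rat_modEq_zero_iff (r := 1) (c := 24) one_ne_zero (by norm_num)]
    push_cast
    rw [one_mul]
    refine iff_of_eq (congrArg (· ≡ 0 [PMOD (24 : ℚ)]) (Finset.sum_congr rfl fun p hp => ?_))
    obtain ⟨hm, -, hh0, -⟩ := ModularUnits.mem_pairs hN0 hp
    have h1 := congrArg (Nat.cast : ℕ → ℚ) (ModularUnits.cofactor_mul hN0 hp)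
    push_cast at h1
    have hm' : (p.1 : ℚ) ≠ 0 := by exact_mod_cast hm.ne'
    have hh' : (ModularUnits.h N p.1 : ℚ) ≠ 0 := by exact_mod_cast hh0.ne'
    congr 1
    rw [eq_div_iff (mul_ne_zero hm' (pow_ne_zero 2 hh')), ← h1]
    ring
  · change ModularUnits.TrivialCharacter N e ↔ _
    rcases Nat.even_or_odd n with hev | hodd
    · have hno : ¬ Odd n := Nat.not_odd_iff_even.2 hev
      have h2N : 2 ∣ N := hN ▸ (hev.two_dvd.trans (dvd_pow_self n two_ne_zero)).mul_right M
      rw [ModularUnits.trivialCharacter_iff_of_even hN0 h2N,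
        ModularUnits.isSquare_oddPart_prod_pairs_iff hN0]
      simp only [hno, hev, false_imp_iff, true_imp_iff, true_and]
      refine and_congr_left fun _ => ?_
      have hnQ : (n : ℚ) ≠ 0 := by exact_mod_cast hn0
      -- Scaling by n/24 turns 24k/h into kn/h, 12 into n/2 and the modulus 24 into n.
      rw [← ModularUnits.rat_modEq_zero_iff (r := n / 24) (c := n) (by positivity) (by push_cast; ring)]
      refine iff_of_eq (congrArg (· ≡ 0 [PMOD (n : ℚ)]) ?_)
      rw [ModularUnits.shiftSum, ModularUnits.ordSum, Finset.mul_sum, ← Finset.sum_add_distrib]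
      rw [Int.cast_sum, Finset.mul_sum]
      refine Finset.sum_congr rfl fun p hp => ?_
      obtain ⟨-, hmN, hh0, -⟩ := ModularUnits.mem_pairs hN0 hp
      have hh' : (ModularUnits.h N p.1 : ℚ) ≠ 0 := by exact_mod_cast hh0.ne'
      simp only [Int.cast_add, Int.cast_mul, Int.cast_natCast, Int.cast_ofNat,
        Nat.cast_div (hh _ hmN) hh', Nat.cast_ofNat]
      field_simp
      ring
    · have hne : ¬ Even n := Nat.not_even_iff_odd.2 hodd
      have hn3 : n ∣ 3 := by
        have : n.Coprime 8 := by
          rw [show 8 = 2 ^ 3 by norm_num]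
          exact (Nat.coprime_two_right.2 hodd).pow_right 3
        exact this.dvd_of_dvd_mul_left (show n ∣ 8 * 3 from hn)
      have hK : ModularUnits.shiftSum N e =
          8 * ∑ p ∈ ModularUnits.pairs N, e p.1 p.2 * (p.2 : ℤ) := by
        rw [ModularUnits.shiftSum, Finset.mul_sum]
        refine Finset.sum_congr rfl fun p hp => ?_
        obtain ⟨-, hmN, hh0, -, hk⟩ := ModularUnits.mem_pairs hN0 hp
        -- h = 1 leaves only k = 0, and h = 3 gives 24/h = 8.
        rcases (Nat.dvd_prime Nat.prime_three).1 ((hhn _ hmN).trans hn3) with h1 | h1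
        · rw [h1] at hk
          have : p.2 = 0 := by omega
          simp [this]
        · rw [h1]
          push_cast
          ring
      rw [ModularUnits.trivialCharacter_iff_of_eight_dvd hN0 e ⟨_, hK⟩,
        ModularUnits.isSquare_prod_pairs_iff hN0]
      simp only [hne, hodd, false_imp_iff, true_imp_iff, and_true]
      refine and_congr_left fun _ => ?_
      rw [Int.modEq_zero_iff_dvd, hK]
      omega
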